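/- Let $\alpha\in(0,1)$ be irrational with continued fraction expansion $\alpha=[0,a_1,a_2,\dots]$, put $a_0=0$, and let $q_0=1$, $q_1=a_1$, $q_{k+1}=a_{k+1}q_k+q_{k-1}$ ($k\ge 1$) be the denominators of its convergents. Let $F_\alpha(t)=t+\alpha \bmod 1$ on $[0,1)$, $I_0=[0,1-\alpha)$, $I_1=[1-\alpha,1)$, and for a word $u=u_0\dots u_{n-1}$ over $\{0,1\}$ let $I_u=\bigcap_{k<n}F_\alpha^{-k}(I_{u_k})$. The Sturmian shift is $$\Sigma_\alpha=\{x\in\{0,1\}^{\mathbb N}\mid I_{x(n)}\neq\emptyset \text{ for all } n\},\qquad x(n)=x_0x_1\dots x_{n-1},$$ with the shift map $\sigma(x)_i=x_{i+1}$. For $x\in\Sigma_\alpha$ let $[x(n)]=\{y\in\Sigma_\alpha\mid y(n)=x(n)\}$, let $\tau(C)=\min\{k>0\mid \sigma^k(C)\cap C\ne\emptyset\}$ for $C\subseteq\Sigma_\alpha$, and define in $[0,\infty]$ the local return rates $$\underline R(x)=\liminf_{n\to\infty}\frac{\tau([x(n)])}{n},\qquad \overline R(x)=\limsup_{n\to\infty}\frac{\tau([x(n)])}{n}.$$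 Put $$\mathbf r_0=\liminf_{k\to\infty}\frac{q_k}{q_{k+1}+q_k-1},\qquad \mathbf r_1=\limsup_{k\to\infty}\frac{q_{k+1}}{q_k},\qquad \gamma=\frac{\sqrt5+1}{2},\qquad M=\limsup_{k\to\infty}a_k .$$ Then: 1. For every $x\in\Sigma_\alpha$, $\mathbf r_0\le\underline R(x)\le\overline R(x)\le\mathbf r_1$. 2. There is a unique $\sigma$-invariant Borel probability measure $\mu$ on $\Sigma_\alpha$, and $\underline R(x)=\mathbf r_0$ and $\overline R(x)=\mathbf r_1$ for $\mu$-almost every $x$. 3. If $(a_k)$ is unbounded, then $\mathbf r_0=0$ and $\mathbf r_1=\infty$. 4. If $(a_k)$ is bounded, then $$\frac1{M+2}\le\mathbf r_0\le\gamma^{-2}<\gamma\le\mathbf r_1\le M+1;$$ moreover $\mathbf r_1=\gamma$ if and only if $M=1$, and $\mathbf r_0=\gamma^{-2}$ if and only if $M=1$. -/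

import Mathlib

namespace SturmianReturn

open Filter MeasureTheory

/-! ### Return times and local return rates of one-sided subshifts -/

/-- The Poincaré return time `τ(M) = min {k > 0 | F^k(M) ∩ M ≠ ∅}` (`⊤` if there is no such `k`). -/
noncomputable def returnTime {X : Type*} (F : X → X) (M : Set X) : ℕ∞ :=
  ⨅ (k : ℕ) (_ : 0 < k ∧ ((F^[k] '' M) ∩ M).Nonempty), (k : ℕ∞)

/-- The shift map on one-sided sequences. -/
def shift {A : Type*} (x : ℕ → A) : ℕ → A := fun i => x (i + 1)

/-- The prefix `x(n) = x_0 x_1 … x_{n-1}`. -/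
def pre {A : Type*} (x : ℕ → A) (n : ℕ) : Fin n → A := fun i => x i

/-- The cylinder `[u]` of a word `u` in `S`. -/
def cylinder {A : Type*} (S : Set (ℕ → A)) {n : ℕ} (u : Fin n → A) : Set S :=
  {y | ∀ i : Fin n, y.1 i = u i}

/-- The lower local return rate `liminf τ([x(n)]) / n` in the shift-invariant set `S`. -/
noncomputable def lowerRate {A : Type*} {S : Set (ℕ → A)} (hS : Set.MapsTo shift S S) (x : S) :
    ENNReal :=
  liminf (fun n : ℕ =>
    ((returnTime (hS.restrict shift S S) (cylinder S (pre x.1 n)) : ℕ∞) : ENNReal) / (n : ENNReal))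
    atTop

/-- The upper local return rate `limsup τ([x(n)]) / n` in the shift-invariant set `S`. -/
noncomputable def upperRate {A : Type*} {S : Set (ℕ → A)} (hS : Set.MapsTo shift S S) (x : S) :
    ENNReal :=
  limsup (fun n : ℕ =>
    ((returnTime (hS.restrict shift S S) (cylinder S (pre x.1 n)) : ℕ∞) : ENNReal) / (n : ENNReal))
    atTop

/-! ### The Sturmian shift -/

/-- The rotation `t ↦ t + α mod 1`; the circle is the interval `[0, 1)`. -/
noncomputable def circleRotation (α : ℝ) (t : ℝ) : ℝ := Int.fract (t + α)

/-- The partition of the circle into `I_0 = [0, 1 - α)` and `I_1 = [1 - α, 1)`. -/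
def basicInterval (α : ℝ) (j : Fin 2) : Set ℝ :=
  if j = 0 then Set.Ico 0 (1 - α) else Set.Ico (1 - α) 1

/-- `I_u = ⋂_{k < |u|} F_α^{-k}(I_{u_k})`, a subset of the circle `[0, 1)`. -/
def codingInterval (α : ℝ) {n : ℕ} (u : Fin n → Fin 2) : Set ℝ :=
  {t | t ∈ Set.Ico (0 : ℝ) 1 ∧ ∀ k : Fin n, (circleRotation α)^[k] t ∈ basicInterval α (u k)}

/-- The Sturmian shift `Σ_α = {x | ∀ n, I_{x(n)} ≠ ∅}`. -/
def sturmian (α : ℝ) : Set (ℕ → Fin 2) :=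
  {x | ∀ n : ℕ, (codingInterval α (pre x n)).Nonempty}

theorem mapsTo_shift (α : ℝ) : Set.MapsTo shift (sturmian α) (sturmian α) := by
  intro x hx n
  obtain ⟨t, -, ht⟩ := hx (n + 1)
  refine ⟨circleRotation α t, ⟨Int.fract_nonneg _, Int.fract_lt_one _⟩, fun k => ?_⟩
  exact ht k.succ

/-- The shift map of the dynamical system `(Σ_α, σ)`. -/
def sturmianMap (α : ℝ) : sturmian α → sturmian α :=
  (mapsTo_shift α).restrict shift (sturmian α) (sturmian α)

/-! ### Continued fractions -/

/-- The partial quotients `a_k`, `k ≥ 1`, of `α = [0, a_1, a_2, …]` in `(0, 1)`; `a_0 = 0`. -/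
noncomputable def cfCoeff (α : ℝ) : ℕ → ℕ
  | 0 => 0
  | k + 1 => ⌊((GenContFract.of α).partDens.get? k).getD 0⌋₊

/-- The denominators `q_k` of the convergents: `q_0 = 1`, `q_1 = a_1` and
`q_{k+2} = a_{k+2} q_{k+1} + q_k`. -/
noncomputable def cfDen (α : ℝ) : ℕ → ℕ
  | 0 => 1
  | 1 => cfCoeff α 1
  | k + 2 => cfCoeff α (k + 2) * cfDen α (k + 1) + cfDen α k

/-- `r_0 = liminf q_k / (q_{k+1} + q_k - 1)`. -/
noncomputable def rZero (α : ℝ) : ENNReal :=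
  liminf (fun k : ℕ =>
    (cfDen α k : ENNReal) / ((cfDen α (k + 1) : ENNReal) + (cfDen α k : ENNReal) - 1)) atTop

/-- `r_1 = limsup q_{k+1} / q_k`. -/
noncomputable def rOne (α : ℝ) : ENNReal :=
  limsup (fun k : ℕ => (cfDen α (k + 1) : ENNReal) / (cfDen α k : ENNReal)) atTop

/-- `M = limsup a_k`, in `[0, ∞]`. -/
noncomputable def coeffLimsup (α : ℝ) : ENNReal :=
  limsup (fun k : ℕ => (cfCoeff α k : ENNReal)) atTop

end SturmianReturn

namespace SturmianReturn

open Filter MeasureTheory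

/-! ### Continued fraction of an irrational number in `(0, 1)` -/

/-! Write `‖·‖` for the distance to the nearest integer and `q_k` for `cfDen α k`. A word of length
`n` codes an arc of the circle cut out by the points `-jα`, `0 ≤ j ≤ n`, and `τ` of its cylinder is
the least `m > 0` for which `‖mα‖` is smaller than the length of that arc. Return times are
therefore governed by best approximation (`abs_cfErr_le`, `one_sided_approximation`).

For every point: if `n ≥ q_{k+1} + q_k - 1`, no gap exceeds `‖q_k α‖`, so `τ ≥ q_{k+1}`
(`cfDen_le_cylReturn`). If `n < q_{k+1}`, every gap is at least `‖q_k α‖ > ‖q_{k+1} α‖`, so `τ ≤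
q_{k+1}` (`cylReturn_le_cfDen`). Letting `k` run gives both general bounds.

For almost every point: the bounds are approached on unions of about `q_{k+1}` disjoint arcs of
length `‖q_k α‖`. Just before `n = q_{k+1} / v` with `v < r_1`, many arcs are already short
(`cfDen_succ_le_cylReturn`); from `n = q_k / v` with `v > r_0`, many are still long
(`cylReturn_le_cfDen_of_floor_ne`). Since `q_{k+1} ‖q_k α‖ ≥ 1/2`, these unions have measure bounded
below for infinitely many `k`, so their limsup has positive measure. Neither rate increases under
the shift, and ergodicity of the rotation turns positive measure into full measure.

Unique ergodicity: longer and longer prefixes of `x` pin down a point of the circle, which makes the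
rotation a measurable factor of the shift. Every invariant measure is pushed to Lebesgue measure,
and the coding inverts the factor map off a countable set (`exists_measurable_factor`).

Constants: `r_0 = 1 / (r_1 + 1)` and `a_{k+1} ≤ q_{k+1} / q_k ≤ a_{k+1} + 1`. Either `a_k ≥ 2`
infinitely often, so that `r_1 ≥ 2 > γ`, or `a_k = 1` eventually and the ratios tend to `γ`
(`rOne_dichotomy`). -/

/-- The orbit of `α` under the Gauss map. -/
noncomputable def gaussOrbit (α : ℝ) : ℕ → ℝ
  | 0 => α
  | k + 1 => Int.fract (gaussOrbit α k)⁻¹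

/-- The numerators `p_k` of the convergents. -/
noncomputable def cfNum (α : ℝ) : ℕ → ℤ
  | 0 => 0
  | 1 => 1
  | k + 2 => cfCoeff α (k + 2) * cfNum α (k + 1) + cfNum α k

/-- The signed approximation error `q_k α - p_k`. -/
noncomputable def cfErr (α : ℝ) (k : ℕ) : ℝ := cfDen α k * α - cfNum α k

section ContinuedFraction

variable {α : ℝ} (hirr : Irrational α) (hα : α ∈ Set.Ioo (0 : ℝ) 1)
include hirr hα

theorem gaussOrbit_mem (k : ℕ) :
    Irrational (gaussOrbit α k) ∧ gaussOrbit α k ∈ Set.Ioo (0 : ℝ) 1 := by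
  induction k with
  | zero => exact ⟨hirr, hα⟩
  | succ k ih =>
    have h : Irrational (gaussOrbit α (k + 1)) := by
      rw [gaussOrbit, Int.fract]
      exact ih.1.inv.sub_intCast _
    refine ⟨h, lt_of_le_of_ne (Int.fract_nonneg _) fun h0 => ?_, Int.fract_lt_one _⟩
    exact h.ne_zero h0.symm

theorem gaussOrbit_pos (k : ℕ) : 0 < gaussOrbit α k := (gaussOrbit_mem hirr hα k).2.1

theorem gaussOrbit_lt_one (k : ℕ) : gaussOrbit α k < 1 := (gaussOrbit_mem hirr hα k).2.2

theorem stream_eq_gaussOrbit (k : ℕ) :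
    ∃ b : ℤ, GenContFract.IntFractPair.stream α k = some ⟨b, gaussOrbit α k⟩ := by
  induction k with
  | zero =>
    refine ⟨⌊α⌋, ?_⟩
    rw [GenContFract.IntFractPair.stream_zero, GenContFract.IntFractPair.of,
      Int.fract_eq_self.2 ⟨hα.1.le, hα.2⟩, gaussOrbit]
  | succ k ih =>
    obtain ⟨b, hb⟩ := ih
    exact ⟨_, GenContFract.IntFractPair.stream_succ_of_some hb (gaussOrbit_pos hirr hα k).ne'⟩

/-- Irrationality keeps the Gauss orbit away from `0`, so the expansion never stops and the default
value `0` in `cfCoeff` is not used. -/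
theorem cfCoeff_succ (k : ℕ) : cfCoeff α (k + 1) = ⌊(gaussOrbit α k)⁻¹⌋₊ := by
  obtain ⟨b, hb⟩ := stream_eq_gaussOrbit hirr hα k
  have h := GenContFract.get?_of_eq_some_of_get?_intFractPair_stream_fr_ne_zero hb
    (gaussOrbit_pos hirr hα k).ne'
  have h0 : 0 ≤ (gaussOrbit α k)⁻¹ := (inv_pos.2 (gaussOrbit_pos hirr hα k)).le
  rw [cfCoeff, GenContFract.partDen_eq_s_b h]
  simp only [Option.getD_some, GenContFract.IntFractPair.of]
  rw [← natCast_floor_eq_intCast_floor h0, Nat.floor_natCast]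

theorem cfCoeff_succ_pos (k : ℕ) : 1 ≤ cfCoeff α (k + 1) := by
  rw [cfCoeff_succ hirr hα, Nat.one_le_floor_iff]
  exact (one_lt_inv₀ (gaussOrbit_pos hirr hα k)).2 (gaussOrbit_lt_one hirr hα k) |>.le

theorem cfCoeff_succ_eq (k : ℕ) :
    (cfCoeff α (k + 1) : ℝ) = (gaussOrbit α k)⁻¹ - gaussOrbit α (k + 1) := by
  have h0 : 0 ≤ (gaussOrbit α k)⁻¹ := (inv_pos.2 (gaussOrbit_pos hirr hα k)).le
  rw [cfCoeff_succ hirr hα, gaussOrbit, Int.fract, natCast_floor_eq_intCast_floor h0]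
  ring

/-- The errors obey the recursion of the convergents, and the Gauss map supplies exactly the factor
needed. Alternating signs and strict decrease of `|cfErr α k|` are read off from this. -/
theorem cfErr_succ (k : ℕ) : cfErr α (k + 1) = - gaussOrbit α (k + 1) * cfErr α k := by
  induction k with
  | zero =>
    have h := cfCoeff_succ_eq hirr hα 0
    simp only [cfErr, cfDen, cfNum, gaussOrbit, zero_add] at h ⊢
    have := hα.1.ne'
    rw [h]
    push_cast
    field_simp
    ring
  | succ k ih =>
    have h := cfCoeff_succ_eq hirr hα (k + 1)
    have h1 : cfErr α (k + 2) = cfCoeff α (k + 2) * cfErr α (k + 1) + cfErr α k := by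
      simp only [cfErr, cfDen, cfNum]
      push_cast
      ring
    have h0 := (gaussOrbit_pos hirr hα (k + 1)).ne'
    rw [h1, h]
    have : cfErr α k = - (gaussOrbit α (k + 1))⁻¹ * cfErr α (k + 1) := by
      rw [ih]; field_simp
    rw [this]
    ring

theorem cfErr_ne_zero (k : ℕ) : cfErr α k ≠ 0 := by
  induction k with
  | zero => simpa [cfErr, cfDen, cfNum] using hα.1.ne'
  | succ k ih =>
    rw [cfErr_succ hirr hα]
    exact mul_ne_zero (neg_ne_zero.2 (gaussOrbit_pos hirr hα _).ne') ih

theorem cfErr_mul_cfErr_succ_neg (k : ℕ) : cfErr α k * cfErr α (k + 1) < 0 := by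
  rw [cfErr_succ hirr hα]
  have h := mul_self_pos.2 (cfErr_ne_zero hirr hα k)
  nlinarith [gaussOrbit_pos hirr hα (k + 1)]

theorem abs_cfErr_pos (k : ℕ) : 0 < |cfErr α k| := abs_pos.2 (cfErr_ne_zero hirr hα k)

theorem abs_cfErr_succ_lt (k : ℕ) : |cfErr α (k + 1)| < |cfErr α k| := by
  rw [cfErr_succ hirr hα, abs_mul, abs_neg, abs_of_pos (gaussOrbit_pos hirr hα _)]
  exact mul_lt_of_lt_one_left (abs_cfErr_pos hirr hα k) (gaussOrbit_lt_one hirr hα _)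

theorem abs_cfErr_lt_one (k : ℕ) : |cfErr α k| < 1 := by
  induction k with
  | zero => simpa [cfErr, cfDen, cfNum, abs_of_pos hα.1] using hα.2
  | succ k ih => exact (abs_cfErr_succ_lt hirr hα k).trans ih

theorem cfDen_pos (k : ℕ) : 1 ≤ cfDen α k := by
  induction k using Nat.strong_induction_on with
  | _ k ih =>
    match k with
    | 0 => exact le_rfl
    | 1 => exact cfCoeff_succ_pos hirr hα 0
    | k + 2 => exact (ih k (by omega)).trans (Nat.le_add_left _ _)

theorem cfDen_add_le (k : ℕ) : cfDen α (k + 1) + cfDen α k ≤ cfDen α (k + 1 + 1) := by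
  have := Nat.mul_le_mul_right (cfDen α (k + 1)) (cfCoeff_succ_pos hirr hα (k + 1))
  rw [cfDen.eq_3]
  exact Nat.add_le_add_right (by simpa using this) _

theorem cfDen_mono : Monotone (cfDen α) := by
  refine monotone_nat_of_le_succ fun k => ?_
  cases k with
  | zero => exact cfDen_pos hirr hα 1
  | succ k => have := cfDen_add_le hirr hα k; omega

theorem le_cfDen (k : ℕ) : k ≤ cfDen α k := by
  induction k with
  | zero => omega
  | succ k ih =>
    cases k with
    | zero => exact cfDen_pos hirr hα 1
    | succ k =>
      have := cfDen_add_le hirr hα k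
      have := cfDen_pos hirr hα k
      omega

theorem tendsto_cfDen : Tendsto (cfDen α) atTop atTop :=
  tendsto_atTop_mono (le_cfDen hirr hα) tendsto_id

omit hirr hα in
theorem cfDen_mul_cfNum_sub (k : ℕ) :
    (cfDen α (k + 1) : ℤ) * cfNum α k - cfDen α k * cfNum α (k + 1) = (-1) ^ (k + 1) := by
  induction k with
  | zero => simp [cfDen, cfNum]
  | succ k ih =>
    rw [pow_succ, ← ih]
    simp only [cfDen, cfNum]
    push_cast
    ring

omit hirr hα in
/-- Every integer vector is a combination of two consecutive convergents. -/
theorem exists_cfDen_combination (k : ℕ) (m l : ℤ) :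
    ∃ x y : ℤ, m = x * cfDen α k + y * cfDen α (k + 1) ∧
      (m : ℝ) * α - l = x * cfErr α k + y * cfErr α (k + 1) := by
  have hd := cfDen_mul_cfNum_sub (α := α) k
  have hs : ((-1 : ℤ) ^ (k + 1)) * (-1) ^ (k + 1) = 1 := by
    rw [← mul_pow]; simp
  -- Cramer's rule; the determinant is `±1` by `cfDen_mul_cfNum_sub`.
  refine ⟨(-1) ^ (k + 1) * (l * cfDen α (k + 1) - m * cfNum α (k + 1)),
    (-1) ^ (k + 1) * (m * cfNum α k - l * cfDen α k), ?_, ?_⟩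
  · linear_combination (-m) * hs + (-m * (-1) ^ (k + 1)) * hd
  · have hd' : ((cfDen α (k + 1) : ℝ) * cfNum α k - cfDen α k * cfNum α (k + 1))
        = (-1) ^ (k + 1) := by exact_mod_cast hd
    have hs' : ((-1 : ℝ) ^ (k + 1)) * (-1) ^ (k + 1) = 1 := by exact_mod_cast hs
    simp only [cfErr]
    push_cast
    linear_combination (l - m * α) * hs' + (l - m * α) * (-1) ^ (k + 1) * hd'

/-- This is the determinant identity rewritten in terms of the errors; since consecutive errors have
opposite signs, the difference becomes a sum of absolute values. -/
theorem cfDen_mul_abs_cfErr_add (k : ℕ) :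
    cfDen α (k + 1) * |cfErr α k| + cfDen α k * |cfErr α (k + 1)| = 1 := by
  have hd' : ((cfDen α (k + 1) : ℝ) * cfNum α k - cfDen α k * cfNum α (k + 1))
      = (-1) ^ (k + 1) := by exact_mod_cast cfDen_mul_cfNum_sub (α := α) k
  have h1 : |cfDen α (k + 1) * cfErr α k - cfDen α k * cfErr α (k + 1)| = 1 := by
    have : cfDen α (k + 1) * cfErr α k - cfDen α k * cfErr α (k + 1) = -(-1 : ℝ) ^ (k + 1) := by
      rw [← hd']; simp only [cfErr]; ring
    rw [this]; simp
  have h2 := cfErr_mul_cfErr_succ_neg hirr hα k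
  have hq : (0 : ℝ) ≤ cfDen α k := Nat.cast_nonneg _
  have hq' : (0 : ℝ) ≤ cfDen α (k + 1) := Nat.cast_nonneg _
  rcases lt_or_gt_of_ne (cfErr_ne_zero hirr hα k) with h | h
  · have h4 : 0 < cfErr α (k + 1) := by nlinarith
    rw [abs_of_nonpos (by nlinarith)] at h1
    rw [abs_of_neg h, abs_of_pos h4]
    linarith
  · have h4 : cfErr α (k + 1) < 0 := by nlinarith
    rw [abs_of_nonneg (by nlinarith)] at h1
    rw [abs_of_pos h, abs_of_neg h4]
    linarith

/-- The second summand in `cfDen_mul_abs_cfErr_add` is at most the first. This bound, uniform in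
`k`, is what gives the exceptional unions of arcs positive measure. -/
theorem one_half_le_cfDen_mul_abs_cfErr (k : ℕ) : 1 / 2 ≤ cfDen α (k + 1) * |cfErr α k| := by
  have h := cfDen_mul_abs_cfErr_add hirr hα k
  have h1 : (cfDen α k : ℝ) ≤ cfDen α (k + 1) := by exact_mod_cast cfDen_mono hirr hα k.le_succ
  have h2 := (abs_cfErr_succ_lt hirr hα k).le
  have := mul_le_mul h1 h2 (abs_nonneg _) (Nat.cast_nonneg _)
  linarith

theorem tendsto_abs_cfErr : Tendsto (fun k => |cfErr α k|) atTop (nhds 0) := by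
  have h : Tendsto (fun k => ((cfDen α (k + 1) : ℝ))⁻¹) atTop (nhds 0) :=
    tendsto_inv_atTop_zero.comp (tendsto_natCast_atTop_atTop.comp
      ((tendsto_cfDen hirr hα).comp (tendsto_add_atTop_nat 1)))
  refine squeeze_zero (fun k => abs_nonneg _) (fun k => ?_) h
  have h1 := cfDen_mul_abs_cfErr_add hirr hα k
  have h2 : (0 : ℝ) < cfDen α (k + 1) := by exact_mod_cast cfDen_pos hirr hα (k + 1)
  rw [← one_div, le_div_iff₀ h2]
  have : 0 ≤ cfDen α k * |cfErr α (k + 1)| := by positivity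
  linarith

/-- The law of best approximation. -/
theorem abs_cfErr_le (k m : ℕ) (l : ℤ) (hm : 0 < m) (hm' : m < cfDen α (k + 1)) :
    |cfErr α k| ≤ |m * α - l| := by
  obtain ⟨x, y, h1, h2⟩ := exists_cfDen_combination (α := α) k m l
  push_cast at h2
  rw [h2]
  have hs := cfErr_mul_cfErr_succ_neg hirr hα k
  have hq : (1 : ℤ) ≤ cfDen α k := by exact_mod_cast cfDen_pos hirr hα k
  have hq' : (1 : ℤ) ≤ cfDen α (k + 1) := by exact_mod_cast cfDen_pos hirr hα (k + 1)
  have hm1 : (0 : ℤ) < m := by exact_mod_cast hm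
  have hm2 : (m : ℤ) < cfDen α (k + 1) := by exact_mod_cast hm'
  -- The range of `m` forces `x ≠ 0` and `x`, `y` of opposite sign. The errors have opposite signs
  -- too, so the two terms reinforce each other.
  have hxy : (1 ≤ x ∧ y ≤ 0) ∨ (x ≤ -1 ∧ 0 ≤ y) := by
    rcases le_or_gt y 0 with hy | hy
    · left
      exact ⟨by by_contra hx; nlinarith, hy⟩
    · right
      exact ⟨by by_contra hx; nlinarith, hy.le⟩
  rcases lt_or_gt_of_ne (cfErr_ne_zero hirr hα k) with h | h
  · have h4 : 0 < cfErr α (k + 1) := by nlinarith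
    rcases hxy with ⟨hx, hy⟩ | ⟨hx, hy⟩ <;> rify at hx hy <;> rw [abs_of_neg h, le_abs]
    · right; nlinarith
    · left; nlinarith
  · have h4 : cfErr α (k + 1) < 0 := by nlinarith
    rcases hxy with ⟨hx, hy⟩ | ⟨hx, hy⟩ <;> rify at hx hy <;> rw [abs_of_pos h, le_abs]
    · left; nlinarith
    · right; nlinarith

/-- One-sided approximation before `q_{k+1} + q_k`: if `m α - l` has the sign of `q_k α - p_k`,
it is at least as large, and otherwise it is at least as large as `q_{k+1} α - p_{k+1}`. -/
theorem one_sided_approximation (k m : ℕ) (l : ℤ) (hm : 0 < m)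
    (hm' : m < cfDen α (k + 1) + cfDen α k) :
    (0 < cfErr α k → m * α - l ≤ cfErr α (k + 1) ∨ cfErr α k ≤ m * α - l) ∧
    (cfErr α k < 0 → cfErr α (k + 1) ≤ m * α - l ∨ m * α - l ≤ cfErr α k) := by
  obtain ⟨x, y, h1, h2⟩ := exists_cfDen_combination (α := α) k m l
  push_cast at h2
  rw [h2]
  have hs := cfErr_mul_cfErr_succ_neg hirr hα k
  have hq : (1 : ℤ) ≤ cfDen α k := by exact_mod_cast cfDen_pos hirr hα k
  have hq' : (1 : ℤ) ≤ cfDen α (k + 1) := by exact_mod_cast cfDen_pos hirr hα (k + 1)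
  have hm1 : (0 : ℤ) < m := by exact_mod_cast hm
  have hm2 : (m : ℤ) < cfDen α (k + 1) + cfDen α k := by exact_mod_cast hm'
  -- Two positive coefficients would give `m ≥ q_{k+1} + q_k`. Now `x = 0` can occur, for instance
  -- at `m = q_{k+1}`.
  have hxy : (1 ≤ x ∧ y ≤ 0) ∨ (x ≤ 0 ∧ 1 ≤ y) := by
    rcases le_or_gt y 0 with hy | hy
    · left
      exact ⟨by by_contra hx; nlinarith, hy⟩
    · right
      exact ⟨by by_contra hx; nlinarith, hy⟩
  refine ⟨fun h => ?_, fun h => ?_⟩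
  · have h4 : cfErr α (k + 1) < 0 := by nlinarith
    rcases hxy with ⟨hx, hy⟩ | ⟨hx, hy⟩ <;> rify at hx hy
    · right; nlinarith
    · left; nlinarith
  · have h4 : 0 < cfErr α (k + 1) := by nlinarith
    rcases hxy with ⟨hx, hy⟩ | ⟨hx, hy⟩ <;> rify at hx hy
    · right; nlinarith
    · left; nlinarith

end ContinuedFraction

/-! ### Coding of real numbers by floors -/

/-- The itinerary of `t` under the rotation by `α`, for the partition `{I_0, I_1}`. -/
noncomputable def code (α t : ℝ) : ℕ → Fin 2 :=
  fun k => if ⌊t + (k + 1 : ℕ) * α⌋ = ⌊t + k * α⌋ then 0 else 1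

theorem code_add_mul (α t : ℝ) (m k : ℕ) : code α (t + m * α) k = code α t (m + k) := by
  unfold code
  congr 3 <;> push_cast <;> ring

theorem code_add_intCast (α t : ℝ) (l : ℤ) : code α (t + l) = code α t := by
  ext1 k
  unfold code
  rw [add_right_comm, Int.floor_add_intCast, add_right_comm, Int.floor_add_intCast]
  simp

theorem code_fract (α t : ℝ) : code α (Int.fract t) = code α t := by
  rw [← code_add_intCast α (Int.fract t) ⌊t⌋, Int.fract_add_floor]

theorem code_congr {α t s : ℝ} {n : ℕ} (h : ∀ j ≤ n, ⌊t + j * α⌋ = ⌊s + j * α⌋) :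
    ∀ k < n, code α t k = code α s k := by
  intro k hk
  rw [code, code, h k hk.le, h (k + 1) hk]

/-- The hypothesis `h` says that no cutting point `-iα + l` with `i ≤ n` lies in `(a, b]`. By
monotonicity all the floors are then constant on `[a, b]`. -/
theorem code_congr_of_le_of_le {α a b t : ℝ} {n : ℕ} (hat : a ≤ t) (htb : t ≤ b)
    (h : ∀ i ≤ n, ∀ l : ℤ, a + i * α < l → b + i * α < l) :
    (∀ k < n, code α a k = code α t k) ∧ ∀ k < n, code α b k = code α t k := by
  have h1 : ∀ i ≤ n, ⌊b + i * α⌋ ≤ ⌊a + i * α⌋ := by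
    intro i hi
    have := h i hi (⌊a + i * α⌋ + 1) (by push_cast; exact Int.lt_floor_add_one _)
    exact Int.lt_add_one_iff.1 (Int.floor_lt.2 this)
  have h2 : ∀ i : ℕ, ⌊a + i * α⌋ ≤ ⌊t + i * α⌋ := fun i => Int.floor_le_floor (by linarith)
  have h3 : ∀ i : ℕ, ⌊t + i * α⌋ ≤ ⌊b + i * α⌋ := fun i => Int.floor_le_floor (by linarith)
  exact ⟨code_congr fun j hj => by have := h1 j hj; have := h2 j; have := h3 j; omega,
    code_congr fun j hj => by have := h1 j hj; have := h2 j; have := h3 j; omega⟩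

section Coding

variable {α : ℝ} (hα : α ∈ Set.Ioo (0 : ℝ) 1)
include hα

theorem floor_add_eq_or (y : ℝ) : ⌊y + α⌋ = ⌊y⌋ ∨ ⌊y + α⌋ = ⌊y⌋ + 1 := by
  have h1 : ⌊y⌋ ≤ ⌊y + α⌋ := Int.floor_le_floor (by linarith [hα.1])
  have h2 : ⌊y + α⌋ < ⌊y⌋ + 2 := by
    rw [Int.floor_lt]; push_cast
    linarith [hα.2, Int.lt_floor_add_one y]
  omega

theorem fract_mem_basicInterval_iff (y : ℝ) (j : Fin 2) :
    Int.fract y ∈ basicInterval α j ↔ (if ⌊y + α⌋ = ⌊y⌋ then (0 : Fin 2) else 1) = j := by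
  have h0 := Int.fract_nonneg y
  have h1 := Int.fract_lt_one y
  have h2 : ⌊y + α⌋ = ⌊y⌋ ↔ Int.fract y < 1 - α := by
    rw [Int.floor_eq_iff, Int.fract]
    have := Int.floor_le y
    constructor
    · rintro ⟨-, h⟩; linarith
    · intro h; exact ⟨by linarith [hα.1], by linarith⟩
  rw [basicInterval]
  by_cases h : Int.fract y < 1 - α <;> simp only [h2, h, if_true, if_false]
  · fin_cases j <;> simp [h, h0]
    intro; linarith
  · have h' := not_lt.1 h
    fin_cases j <;> simp [h', h1]

/-- As `0 < α < 1`, each step raises the floor by `0` or `1`, and the code records which; the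
initial floor then determines all the others. -/
theorem floor_eq_of_code_eq {t s : ℝ} {n : ℕ} (h0 : ⌊t⌋ = ⌊s⌋)
    (h : ∀ k < n, code α t k = code α s k) : ∀ j ≤ n, ⌊t + j * α⌋ = ⌊s + j * α⌋ := by
  intro j
  induction j with
  | zero => simpa using h0
  | succ j ih =>
    intro hj
    have h1 := ih (by omega)
    have h2 := h j hj
    have e : ∀ y : ℝ, y + (j + 1 : ℕ) * α = y + j * α + α := fun y => by push_cast; ring
    rw [code, code, e, e] at h2
    rw [e, e]
    rcases floor_add_eq_or hα (t + j * α) with h3 | h3 <;>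
    rcases floor_add_eq_or hα (s + j * α) with h4 | h4 <;> simp_all

omit hα in
theorem iterate_circleRotation {t : ℝ} (ht : t ∈ Set.Ico (0 : ℝ) 1) (k : ℕ) :
    (circleRotation α)^[k] t = Int.fract (t + k * α) := by
  induction k with
  | zero => simpa using (Int.fract_eq_self.2 ht).symm
  | succ k ih =>
    rw [Function.iterate_succ_apply', ih, circleRotation]
    have : Int.fract (t + k * α) + α = t + (k + 1 : ℕ) * α - (⌊t + k * α⌋ : ℤ) := by
      rw [Int.fract]; push_cast; ring
    rw [this, Int.fract_sub_intCast]

theorem mem_codingInterval_iff {n : ℕ} (u : Fin n → Fin 2) (t : ℝ) :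
    t ∈ codingInterval α u ↔ t ∈ Set.Ico (0 : ℝ) 1 ∧ ∀ k : Fin n, code α t k = u k := by
  refine and_congr_right fun ht => forall_congr' fun k => ?_
  rw [iterate_circleRotation ht, fract_mem_basicInterval_iff hα, code]
  have : t + ((k : ℕ) + 1 : ℕ) * α = t + (k : ℕ) * α + α := by push_cast; ring
  rw [this]

theorem code_mem_sturmian (t : ℝ) : code α t ∈ sturmian α := fun n =>
  ⟨Int.fract t, (mem_codingInterval_iff hα _ _).2
    ⟨⟨Int.fract_nonneg _, Int.fract_lt_one _⟩, fun k => by rw [code_fract]; rfl⟩⟩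

theorem exists_code_eq {x : ℕ → Fin 2} (hx : x ∈ sturmian α) (n : ℕ) :
    ∃ t ∈ Set.Ico (0 : ℝ) 1, ∀ k < n, code α t k = x k := by
  obtain ⟨t, ht⟩ := hx n
  obtain ⟨h0, h1⟩ := (mem_codingInterval_iff hα _ _).1 ht
  exact ⟨t, h0, fun k hk => h1 ⟨k, hk⟩⟩

end Coding

/-! ### Return times of Sturmian cylinders -/

/-- The return time `τ([x(n)])` in the Sturmian shift. -/
noncomputable abbrev cylReturn (α : ℝ) (x : ℕ → Fin 2) (n : ℕ) : ℕ∞ :=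
  returnTime ((mapsTo_shift α).restrict shift (sturmian α) (sturmian α))
    (cylinder (sturmian α) (pre x n))

theorem coe_iterate_restrict_shift {α : ℝ} (m : ℕ) (y : sturmian α) (k : ℕ) :
    ((((mapsTo_shift α).restrict shift (sturmian α) (sturmian α))^[m] y : sturmian α) :
      ℕ → Fin 2) k = y.1 (m + k) := by
  induction m generalizing y with
  | zero => simp
  | succ m ih =>
    rw [Function.iterate_succ_apply, ih]
    change y.1 (m + k + 1) = _
    rw [Nat.add_right_comm]

section ReturnTime

variable {α : ℝ} (hα : α ∈ Set.Ioo (0 : ℝ) 1)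
include hα

omit hα in
theorem cylReturn_le_of_mem {x : ℕ → Fin 2} {n m : ℕ} (hm : 0 < m) {y : ℕ → Fin 2}
    (hy : y ∈ sturmian α) (h1 : ∀ k < n, y k = x k) (h2 : ∀ k < n, y (m + k) = x k) :
    cylReturn α x n ≤ m := by
  refine iInf₂_le m ⟨hm, _, ⟨⟨y, hy⟩, fun i => h1 i i.2, rfl⟩, fun i => ?_⟩
  rw [coe_iterate_restrict_shift]
  exact h2 i i.2

omit hα in
theorem le_cylReturn_of_mem {x : ℕ → Fin 2} {n : ℕ} {N : ℕ∞}
    (h : ∀ m : ℕ, ∀ y ∈ sturmian α, 0 < m → (∀ k < n, y k = x k) → (∀ k < n, y (m + k) = x k) →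
      N ≤ m) : N ≤ cylReturn α x n := by
  refine le_iInf₂ fun m hm => ?_
  obtain ⟨hm, _, ⟨y, hy, rfl⟩, hy'⟩ := hm
  refine h m y.1 y.2 hm (fun k hk => hy ⟨k, hk⟩) fun k hk => ?_
  rw [← coe_iterate_restrict_shift]
  exact hy' ⟨k, hk⟩

theorem cylReturn_le {x : ℕ → Fin 2} {n m : ℕ} (hm : 0 < m) (s : ℝ)
    (h1 : ∀ k < n, code α s k = x k) (h2 : ∀ k < n, code α (s + m * α) k = x k) :
    cylReturn α x n ≤ m :=
  cylReturn_le_of_mem hm (code_mem_sturmian hα s) h1 fun k hk => by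
    rw [← code_add_mul]; exact h2 k hk

/-- A point of the Sturmian shift need not be the code of a real number, but a return at time `m`
involves only its first `m + n` letters, and these are coded by some `s`. -/
theorem le_cylReturn {x : ℕ → Fin 2} {n N : ℕ}
    (h : ∀ m : ℕ, ∀ s : ℝ, 0 < m → (∀ k < n, code α s k = x k) →
      (∀ k < n, code α (s + m * α) k = x k) → N ≤ m) : N ≤ cylReturn α x n := by
  refine le_cylReturn_of_mem fun m y hy hm h1 h2 => ?_
  obtain ⟨s, -, hs⟩ := exists_code_eq hα hy (m + n)
  refine Nat.cast_le.2 (h m s hm (fun k hk => ?_) fun k hk => ?_)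
  · rw [hs k (by omega), h1 k hk]
  · rw [code_add_mul, hs _ (by omega), h2 k hk]

/-- A return at time `m` yields two representatives that differ by `mα - l` for an integer `l`; for
`m < q_{k+1}` this is too large by best approximation. -/
theorem le_cylReturn_of_abs_lt {x : ℕ → Fin 2} (hirr : Irrational α) {n k : ℕ}
    (h : ∀ a ∈ Set.Ico (0 : ℝ) 1, ∀ b ∈ Set.Ico (0 : ℝ) 1, (∀ k < n, code α a k = x k) →
      (∀ k < n, code α b k = x k) → |b - a| < |cfErr α k|) :
    cfDen α (k + 1) ≤ cylReturn α x n := by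
  refine le_cylReturn hα fun m s hm h1 h2 => ?_
  by_contra! hlt
  have h3 := h (Int.fract s) ⟨Int.fract_nonneg _, Int.fract_lt_one _⟩
    (Int.fract (s + m * α)) ⟨Int.fract_nonneg _, Int.fract_lt_one _⟩
    (by simpa only [code_fract] using h1) (by simpa only [code_fract] using h2)
  have h4 := abs_cfErr_le hirr hα k m (⌊s + m * α⌋ - ⌊s⌋) hm hlt
  have h5 : Int.fract (s + m * α) - Int.fract s = m * α - ((⌊s + m * α⌋ - ⌊s⌋ : ℤ) : ℝ) := by
    rw [Int.fract, Int.fract]; push_cast; ring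
  rw [h5] at h3
  exact absurd h3 (not_lt.2 h4)

variable (hirr : Irrational α)
include hirr

/-- The cutting points with index below `q_{k+1} + q_k` leave no gap longer than `‖q_k α‖`. Take the
index whose cutting point is nearest to the right of `y`. If it were farther than `‖q_k α‖`, adding
one of `q_k`, `q_{k+1}` to the index or subtracting the other would stay in range and give a nearer
point, still to the right. -/
theorem exists_lt_le_add_abs_cfErr (k : ℕ) (y : ℝ) :
    ∃ j < cfDen α (k + 1) + cfDen α k, ∃ N : ℤ, y + j * α < N ∧ N ≤ y + j * α + |cfErr α k| := by
  have hq := cfDen_pos hirr hα k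
  obtain ⟨j, hj, hmin⟩ := Finset.exists_min_image (Finset.range (cfDen α (k + 1) + cfDen α k))
    (fun j : ℕ => (⌊y + j * α⌋ : ℝ) + 1 - (y + j * α)) ⟨0, by simp; omega⟩
  rw [Finset.mem_range] at hj
  have hmin' : ∀ i < cfDen α (k + 1) + cfDen α k, ∀ M : ℤ, y + i * α < M →
      (⌊y + j * α⌋ : ℝ) + 1 - (y + j * α) ≤ M - (y + i * α) := by
    intro i hi M hM
    refine (hmin i (Finset.mem_range.2 hi)).trans ?_
    have : ⌊y + i * α⌋ + 1 ≤ M := Int.floor_lt.2 hM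
    rify at this
    linarith
  refine ⟨j, hj, ⌊y + j * α⌋ + 1, by push_cast; exact Int.lt_floor_add_one _, ?_⟩
  by_contra! hlt
  push_cast at hlt
  have hs := cfErr_mul_cfErr_succ_neg hirr hα k
  have hl := abs_cfErr_succ_lt hirr hα k
  rcases lt_or_gt_of_ne (cfErr_ne_zero hirr hα k) with h | h
  · have h4 : 0 < cfErr α (k + 1) := by nlinarith
    rw [abs_of_neg h] at hlt hl
    rw [abs_of_pos h4] at hl
    rcases lt_or_ge j (cfDen α k) with hjk | hjk
    · have := hmin' (j + cfDen α (k + 1)) (by omega) (⌊y + j * α⌋ + 1 + cfNum α (k + 1))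
      simp only [cfErr] at *
      push_cast at this
      have := this (by linarith)
      linarith
    · have := hmin' (j - cfDen α k) (by omega) (⌊y + j * α⌋ + 1 - cfNum α k)
      simp only [cfErr] at *
      push_cast [Nat.cast_sub hjk] at this
      have := this (by linarith)
      linarith
  · have h4 : cfErr α (k + 1) < 0 := by nlinarith
    rw [abs_of_pos h] at hlt hl
    rw [abs_of_neg h4] at hl
    rcases lt_or_ge j (cfDen α (k + 1)) with hjk | hjk
    · have := hmin' (j + cfDen α k) (by omega) (⌊y + j * α⌋ + 1 + cfNum α k)
      simp only [cfErr] at *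
      push_cast at this
      have := this (by linarith)
      linarith
    · have := hmin' (j - cfDen α (k + 1)) (by omega) (⌊y + j * α⌋ + 1 - cfNum α (k + 1))
      simp only [cfErr] at *
      push_cast [Nat.cast_sub hjk] at this
      have := this (by linarith)
      linarith

/-- Points with the same code of length at least `q_{k+1} + q_k - 1` are `‖q_k α‖`-close. -/
theorem abs_sub_lt_of_code_eq {n k : ℕ} (hn : cfDen α (k + 1) + cfDen α k ≤ n + 1) {a b : ℝ}
    (ha : a ∈ Set.Ico (0 : ℝ) 1) (hb : b ∈ Set.Ico (0 : ℝ) 1)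
    (h : ∀ i < n, code α a i = code α b i) : |b - a| < |cfErr α k| := by
  wlog hab : a ≤ b generalizing a b
  · rw [abs_sub_comm]
    exact this hb ha (fun i hi => (h i hi).symm) (le_of_not_ge hab)
  have hfl := floor_eq_of_code_eq hα
    (by rw [Int.floor_eq_zero_iff.2 ha, Int.floor_eq_zero_iff.2 hb]) h
  rw [abs_of_nonneg (sub_nonneg.2 hab)]
  by_contra! hlt
  obtain ⟨j, hj, N, h1, h2⟩ := exists_lt_le_add_abs_cfErr hα hirr k a
  have h3 := hfl j (by omega)
  have h4 : ⌊a + j * α⌋ < N := Int.floor_lt.2 h1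
  have h5 : N ≤ ⌊b + j * α⌋ := Int.le_floor.2 (by linarith)
  omega

theorem cfDen_le_cylReturn {x : ℕ → Fin 2} {n k : ℕ}
    (hn : cfDen α (k + 1) + cfDen α k ≤ n + 1) : cfDen α (k + 1) ≤ cylReturn α x n :=
  le_cylReturn_of_abs_lt hα hirr fun _ ha _ hb h1 h2 =>
    abs_sub_lt_of_code_eq hα hirr hn ha hb fun i hi => (h1 i hi).trans (h2 i hi).symm

/-- The indices of the cutting points differ by less than `q_{k+1}`, so every gap is at least `‖q_k
α‖`. A translation by the smaller `‖q_{k+1} α‖` can be fitted inside it. -/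
theorem cylReturn_le_cfDen {x : ℕ → Fin 2} (hx : x ∈ sturmian α) {n k : ℕ}
    (hn : n < cfDen α (k + 1)) : cylReturn α x n ≤ cfDen α (k + 1) := by
  obtain ⟨t, ht, htx⟩ := exists_code_eq hα hx n
  obtain ⟨a, ha, hmax⟩ := Finset.exists_max_image (Finset.range (n + 1))
    (fun j : ℕ => (⌊t + j * α⌋ : ℝ) - j * α) ⟨0, by simp⟩
  obtain ⟨b, hb, hmin⟩ := Finset.exists_min_image (Finset.range (n + 1))
    (fun j : ℕ => (⌊t + j * α⌋ : ℝ) + 1 - j * α) ⟨0, by simp⟩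
  -- `[L, R)` is the set of reals with the same floors as `t` at all times up to `n`.
  set L : ℝ := ⌊t + a * α⌋ - a * α with hL
  set R : ℝ := ⌊t + b * α⌋ + 1 - b * α with hR
  rw [Finset.mem_range] at ha hb
  have hLt : L ≤ t := by linarith [Int.floor_le (t + a * α)]
  have htR : t < R := by linarith [Int.lt_floor_add_one (t + b * α)]
  have hmem : ∀ y, L ≤ y → y < R → ∀ k < n, code α y k = x k := by
    intro y hLy hyR i hi
    rw [← htx i hi]
    refine code_congr (n := n) (fun j hj => ?_) i hi
    have h1 := hmax j (Finset.mem_range.2 (by omega))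
    have h2 := hmin j (Finset.mem_range.2 (by omega))
    rw [Int.floor_eq_iff]
    exact ⟨by linarith, by linarith⟩
  have hlen : |cfErr α k| ≤ R - L := by
    -- The endpoints come from the cutting points of index `a` and `b`. If `a = b`, the interval is
    -- the whole circle, of length `1`.
    rcases lt_trichotomy a b with h | h | h
    · have := abs_cfErr_le hirr hα k (b - a) (⌊t + b * α⌋ + 1 - ⌊t + a * α⌋) (by omega) (by omega)
      push_cast [Nat.cast_sub h.le] at this
      rw [abs_of_nonpos (a := ((b : ℝ) - a) * α - _) (by linarith)] at this
      linarith
    · have : R - L = 1 := by rw [hL, hR, h]; ring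
      rw [this]
      exact (abs_cfErr_lt_one hirr hα k).le
    · have := abs_cfErr_le hirr hα k (a - b) (⌊t + a * α⌋ - ⌊t + b * α⌋ - 1) (by omega) (by omega)
      push_cast [Nat.cast_sub h.le] at this
      rw [abs_of_nonneg (a := ((a : ℝ) - b) * α - _) (by linarith)] at this
      linarith
  have hlt := (abs_cfErr_succ_lt hirr hα k).trans_le hlen
  have hcode : ∀ s : ℝ, code α (s + cfDen α (k + 1) * α) = code α (s + cfErr α (k + 1)) := by
    intro s
    rw [← code_add_intCast α (s + cfErr α (k + 1)) (cfNum α (k + 1)), cfErr]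
    congr 1; ring
  -- The starting point is chosen according to the sign of the displacement, so that it and its
  -- translate both lie in `[L, R)`.
  rcases lt_or_gt_of_ne (cfErr_ne_zero hirr hα (k + 1)) with h | h
  · rw [abs_of_neg h] at hlt
    refine cylReturn_le hα (cfDen_pos hirr hα _) (L - cfErr α (k + 1))
      (hmem _ (by linarith) (by linarith)) ?_
    rw [hcode]
    exact hmem _ (by linarith) (by linarith)
  · rw [abs_of_pos h] at hlt
    refine cylReturn_le hα (cfDen_pos hirr hα _) L (hmem _ le_rfl (by linarith)) ?_
    rw [hcode]
    exact hmem _ (by linarith) (by linarith)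

-- Both points lie between an integer and its translate by `-D`, in a half-open interval of length
-- at most `|D|`; this is why the inequality is strict.
omit hα hirr in
theorem abs_sub_lt_of_floor_add_ne {a b D : ℝ} (h1 : ⌊a⌋ = ⌊b⌋) (h2 : ⌊a + D⌋ = ⌊b + D⌋)
    (h3 : ⌊a + D⌋ ≠ ⌊a⌋) : |a - b| < |D| := by
  have ha := Int.floor_le a
  have ha' := Int.lt_floor_add_one a
  have hb := Int.floor_le b
  have hb' := Int.lt_floor_add_one b
  have hc := Int.floor_le (a + D)
  have hc' := Int.lt_floor_add_one (a + D)
  have hd := Int.floor_le (b + D)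
  have hd' := Int.lt_floor_add_one (b + D)
  rw [← h1] at hb hb'
  rw [← h2] at hd hd'
  rcases lt_or_gt_of_ne h3 with h | h
  · have h' : ⌊a + D⌋ + 1 ≤ ⌊a⌋ := h
    rify at h'
    rw [abs_of_nonpos (a := D) (by linarith), abs_lt]
    constructor <;> linarith
  · have h' : ⌊a⌋ + 1 ≤ ⌊a + D⌋ := h
    rify at h'
    rw [abs_of_nonneg (a := D) (by linarith), abs_lt]
    constructor <;> linarith

/-- A point between `-jα` and `-(j + q_k)α` with `j + q_k ≤ n` lies in a short interval. -/
theorem cfDen_succ_le_cylReturn {x : ℕ → Fin 2} {n k j : ℕ} {t : ℝ}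
    (htx : ∀ k < n, code α t k = x k) (hj : j + cfDen α k ≤ n)
    (h : ⌊t + j * α + cfErr α k⌋ ≠ ⌊t + j * α⌋) : cfDen α (k + 1) ≤ cylReturn α x n := by
  wlog ht : t ∈ Set.Ico (0 : ℝ) 1 generalizing t
  · refine this (t := Int.fract t) (by simpa only [code_fract] using htx) ?_
      ⟨Int.fract_nonneg _, Int.fract_lt_one _⟩
    have e1 : Int.fract t + j * α + cfErr α k = t + j * α + cfErr α k - (⌊t⌋ : ℤ) := by
      rw [Int.fract]; ring
    have e2 : Int.fract t + j * α = t + j * α - (⌊t⌋ : ℤ) := by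
      rw [Int.fract]; ring
    rw [e1, e2, Int.floor_sub_intCast, Int.floor_sub_intCast]
    omega
  -- The word fixes the floors at times `j` and `j + q_k`, both at most `n`, and `q_k α` equals
  -- `cfErr α k` up to an integer.
  have key : ∀ a ∈ Set.Ico (0 : ℝ) 1, (∀ k < n, code α a k = x k) →
      ⌊t + j * α⌋ = ⌊a + j * α⌋ ∧ ⌊t + j * α + cfErr α k⌋ = ⌊a + j * α + cfErr α k⌋ := by
    intro a ha hax
    have hfl := floor_eq_of_code_eq (n := n) (t := t) (s := a) hα
      (by rw [Int.floor_eq_zero_iff.2 ha, Int.floor_eq_zero_iff.2 ht])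
      fun i hi => (htx i hi).trans (hax i hi).symm
    refine ⟨hfl j (by omega), ?_⟩
    have e : ∀ y : ℝ, y + j * α + cfErr α k =
        y + (j + cfDen α k : ℕ) * α - (cfNum α k : ℤ) := by
      intro y; rw [cfErr]; push_cast; ring
    rw [e, e, Int.floor_sub_intCast, Int.floor_sub_intCast, hfl _ hj]
  refine le_cylReturn_of_abs_lt hα hirr fun a ha b hb h1 h2 => ?_
  obtain ⟨ha1, ha2⟩ := key a ha h1
  obtain ⟨hb1, hb2⟩ := key b hb h2
  have := abs_sub_lt_of_floor_add_ne (hb1.symm.trans ha1) (hb2.symm.trans ha2) (by omega)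
  simpa using this

/-- A point between `-jα` and `-(j - q_k)α` with `n < j < q_{k+1} + q_k` lies in a long interval. -/
theorem cylReturn_le_cfDen_of_floor_ne {x : ℕ → Fin 2} {n k j : ℕ} {t : ℝ}
    (htx : ∀ k < n, code α t k = x k) (hj : n < j) (hj' : j < cfDen α (k + 1) + cfDen α k)
    (h : ⌊t + j * α - cfErr α k⌋ ≠ ⌊t + j * α⌋) : cylReturn α x n ≤ cfDen α k := by
  have hcode : ∀ s : ℝ, code α (s + cfDen α k * α) = code α (s + cfErr α k) := by
    intro s
    rw [← code_add_intCast α (s + cfErr α k) (cfNum α k), cfErr]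
    congr 1; ring
  have hs := cfErr_mul_cfErr_succ_neg hirr hα k
  have h0 := Int.floor_le (t + j * α)
  have h0' := Int.lt_floor_add_one (t + j * α)
  rcases lt_or_gt_of_ne (cfErr_ne_zero hirr hα k) with hk | hk
  · have h4 : 0 < cfErr α (k + 1) := by nlinarith
    have h5 : ⌊t + j * α⌋ + 1 ≤ ⌊t + j * α - cfErr α k⌋ := by
      have : ⌊t + j * α⌋ ≤ ⌊t + j * α - cfErr α k⌋ := Int.floor_le_floor (by linarith)
      omega
    have h6 := Int.le_floor.1 h5
    push_cast at h6
    -- `z` is the cutting point of index `j` to the right of `t`. Since `n < j`, one-sided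
    -- approximation with `m = j - i` shows that no index `i ≤ n` cuts `(z + cfErr α k, z]`, so both
    -- ends carry the word of `t`.
    set z : ℝ := ⌊t + j * α⌋ + 1 - j * α with hz
    obtain ⟨hc1, hc2⟩ := code_congr_of_le_of_le (α := α) (n := n) (t := t)
      (a := z + cfErr α k) (b := z) (by linarith) (by linarith) (by
        intro i hi l hl
        have := (one_sided_approximation hirr hα k (j - i) (⌊t + j * α⌋ + 1 - l) (by omega)
          (by omega)).2 hk
        push_cast [Nat.cast_sub (hi.trans hj.le)] at this
        rcases this with h | h <;> linarith)
    refine cylReturn_le hα (cfDen_pos hirr hα _) z (fun i hi => (hc2 i hi).trans (htx i hi)) ?_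
    rw [hcode]
    exact fun i hi => (hc1 i hi).trans (htx i hi)
  · have h4 : cfErr α (k + 1) < 0 := by nlinarith
    have h5 : ⌊t + j * α - cfErr α k⌋ < ⌊t + j * α⌋ := by
      have : ⌊t + j * α - cfErr α k⌋ ≤ ⌊t + j * α⌋ := Int.floor_le_floor (by linarith)
      omega
    have h6 := Int.floor_lt.1 h5
    set z : ℝ := ⌊t + j * α⌋ - j * α with hz
    -- Here the right end `z + cfErr α k` may itself be a cutting point, so the interval is moved
    -- left by `e`: little enough to keep `t` inside and to stay within the uncut stretch of length
    -- `‖q_{k+1} α‖` left of `z`.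
    obtain ⟨e, he0, he1, he2⟩ : ∃ e : ℝ, 0 < e ∧ e ≤ - cfErr α (k + 1) ∧
        e ≤ ⌊t + j * α⌋ - (t + j * α - cfErr α k) :=
      ⟨min _ _, lt_min (neg_pos.2 h4) (sub_pos.2 h6), min_le_left _ _, min_le_right _ _⟩
    obtain ⟨hc1, hc2⟩ := code_congr_of_le_of_le (α := α) (n := n) (t := t)
      (a := z - e) (b := z - e + cfErr α k) (by linarith) (by linarith) (by
        intro i hi l hl
        have := (one_sided_approximation hirr hα k (j - i) (⌊t + j * α⌋ - l) (by omega)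
          (by omega)).1 hk
        push_cast [Nat.cast_sub (hi.trans hj.le)] at this
        rcases this with h | h <;> linarith)
    refine cylReturn_le hα (cfDen_pos hirr hα _) (z - e)
      (fun i hi => (hc1 i hi).trans (htx i hi)) ?_
    rw [hcode]
    exact fun i hi => (hc2 i hi).trans (htx i hi)

end ReturnTime

/-! ### The numbers `r_0`, `r_1` and the partial quotients -/

section Constants

variable {α : ℝ} (hirr : Irrational α) (hα : α ∈ Set.Ioo (0 : ℝ) 1)
include hirr hα

/-- The reciprocal of each term is `q_{k+1} / q_k + 1 - 1 / q_k`, and the last summand tends to `0`.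
-/
theorem rZero_eq_inv : rZero α = (rOne α + 1)⁻¹ := by
  have hq : ∀ k, (cfDen α k : ENNReal) ≠ 0 := fun k =>
    Nat.cast_ne_zero.2 (Nat.one_le_iff_ne_zero.1 (cfDen_pos hirr hα k))
  have hq' : ∀ k, (1 : ENNReal) ≤ cfDen α k := fun k => by exact_mod_cast cfDen_pos hirr hα k
  have hqt : ∀ k, (cfDen α k : ENNReal) ≠ ⊤ := fun k => ENNReal.natCast_ne_top _
  set w : ℕ → ENNReal := fun k =>
    ((cfDen α (k + 1) : ENNReal) + (cfDen α k : ENNReal) - 1) / cfDen α k with hw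
  have h1 : rZero α = (limsup w atTop)⁻¹ := by
    rw [ENNReal.inv_limsup, rZero]
    congr 1
    ext1 k
    rw [hw, ENNReal.inv_div (Or.inl (hqt k)) (Or.inl (hq k))]
  have h2 : Tendsto (fun k => (cfDen α k : ENNReal)⁻¹) atTop (nhds 0) :=
    ENNReal.tendsto_inv_nat_nhds_zero.comp (tendsto_cfDen hirr hα)
  rw [h1, ← ENNReal.limsup_add_of_right_tendsto_zero h2, rOne,
    ← limsup_add_const _ _ _ (by isBoundedDefault) (by isBoundedDefault)]
  congr 2
  ext1 k
  rw [Pi.add_apply, hw, ← one_div, ENNReal.div_add_div_same,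
    tsub_add_cancel_of_le ((hq' k).trans le_add_self), ← ENNReal.div_add_div_same,
    ENNReal.div_self (hq k) (hqt k)]

theorem cfCoeff_le_div (k : ℕ) :
    (cfCoeff α (k + 1) : ENNReal) ≤ (cfDen α (k + 1) : ENNReal) / cfDen α k := by
  rw [ENNReal.le_div_iff_mul_le (Or.inl (by
    exact_mod_cast (Nat.one_le_iff_ne_zero.1 (cfDen_pos hirr hα k)))) (Or.inl (ENNReal.natCast_ne_top _))]
  cases k with
  | zero => simp [cfDen]
  | succ k => rw [cfDen]; exact_mod_cast Nat.le_add_right _ _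

theorem div_le_cfCoeff_add_one (k : ℕ) :
    (cfDen α (k + 1) : ENNReal) / cfDen α k ≤ cfCoeff α (k + 1) + 1 := by
  refine ENNReal.div_le_of_le_mul ?_
  cases k with
  | zero => simp [cfDen]
  | succ k =>
    rw [cfDen, add_mul, one_mul]
    exact_mod_cast Nat.add_le_add_left (cfDen_mono hirr hα k.le_succ) _

theorem rOne_eq_top (h : ¬ BddAbove (Set.range (cfCoeff α))) : rOne α = ⊤ := by
  refine ENNReal.eq_top_of_forall_nnreal_le fun r => ?_
  refine le_limsup_of_frequently_le' (frequently_atTop.2 fun K => ?_)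
  by_contra! hK
  refine h ((Set.finite_range fun i : Fin (K + 1) => cfCoeff α i).bddAbove.union
    (bddAbove_Iic (a := ⌈r⌉₊)) |>.mono ?_)
  rintro _ ⟨k, rfl⟩
  rcases lt_or_ge k (K + 1) with hk | hk
  · exact Or.inl ⟨⟨k, hk⟩, rfl⟩
  · right
    obtain ⟨k, rfl⟩ : ∃ l, k = l + 1 := ⟨k - 1, by omega⟩
    have h1 := (cfCoeff_le_div hirr hα k).trans_lt (hK k (by omega))
    have h2 : ((cfCoeff α (k + 1) : NNReal) : ENNReal) < r := by exact_mod_cast h1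
    have h3 := (ENNReal.coe_lt_coe.1 h2).le.trans (Nat.le_ceil r)
    exact_mod_cast h3

omit hirr hα in
theorem coeffLimsup_eq : coeffLimsup α = limsup (fun k => (cfCoeff α (k + 1) : ENNReal)) atTop :=
  (limsup_nat_add (fun k => (cfCoeff α k : ENNReal)) 1).symm

theorem rOne_le : rOne α ≤ coeffLimsup α + 1 := by
  rw [coeffLimsup_eq, ← limsup_add_const _ _ _ (by isBoundedDefault) (by isBoundedDefault)]
  exact limsup_le_limsup (Eventually.of_forall (div_le_cfCoeff_add_one hirr hα))

theorem coeffLimsup_le_rOne : coeffLimsup α ≤ rOne α := by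
  rw [coeffLimsup_eq]
  exact limsup_le_limsup (Eventually.of_forall (cfCoeff_le_div hirr hα))

/-- Eventually the ratios iterate `v ↦ 1 + 1 / v`, which fixes the golden ratio `γ` and, for `v ≥
1`, contracts the distance to it by `1 / γ`. -/
theorem tendsto_ratio_of_eventually_eq_one (h : ∀ᶠ k in atTop, cfCoeff α (k + 1) = 1) :
    Tendsto (fun k => (cfDen α (k + 1) : ℝ) / cfDen α k) atTop (nhds Real.goldenRatio) := by
  have hq : ∀ k, (0 : ℝ) < cfDen α k := fun k => by exact_mod_cast cfDen_pos hirr hα k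
  obtain ⟨K, hK⟩ := eventually_atTop.1 h
  set v : ℕ → ℝ := fun k => (cfDen α (k + 1) : ℝ) / cfDen α k with hv
  have hφ := Real.goldenRatio_pos
  have hφ2 := Real.goldenRatio_sq
  have hv1 : ∀ k, 1 ≤ v k := fun k => by
    rw [hv, one_le_div (hq k)]
    exact_mod_cast cfDen_mono hirr hα k.le_succ
  have hrec : ∀ k ≥ K, v (k + 1) = 1 + (v k)⁻¹ := by
    intro k hk
    have h1 : cfDen α (k + 1 + 1) = cfDen α (k + 1) + cfDen α k := by
      rw [cfDen.eq_3, hK (k + 1) (by omega), one_mul]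
    have := (hq k).ne'
    have := (hq (k + 1)).ne'
    simp only [hv, h1]
    push_cast
    field_simp
  have hstep : ∀ k ≥ K, |v (k + 1) - Real.goldenRatio| ≤
      Real.goldenRatio⁻¹ * |v k - Real.goldenRatio| := by
    intro k hk
    have h0 : 0 < v k := by linarith [hv1 k]
    have h1 : v (k + 1) - Real.goldenRatio =
        - (v k)⁻¹ * (Real.goldenRatio⁻¹ * (v k - Real.goldenRatio)) := by
      rw [hrec k hk]
      generalize Real.goldenRatio = g at hφ hφ2 ⊢
      generalize v k = w at h0 ⊢
      field_simp
      linear_combination (-w) * hφ2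
    rw [h1, abs_mul, abs_neg, abs_mul (Real.goldenRatio⁻¹), abs_of_pos (inv_pos.2 h0),
      abs_of_pos (inv_pos.2 hφ)]
    exact mul_le_of_le_one_left (by positivity) (inv_le_one_of_one_le₀ (hv1 k))
  have hpow : ∀ i, |v (i + K) - Real.goldenRatio| ≤
      Real.goldenRatio⁻¹ ^ i * |v K - Real.goldenRatio| := by
    intro i
    induction i with
    | zero => simp
    | succ i ih =>
      rw [Nat.add_right_comm, pow_succ', mul_assoc]
      exact (hstep _ (by omega)).trans (mul_le_mul_of_nonneg_left ih (inv_pos.2 hφ).le)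
  rw [← tendsto_add_atTop_iff_nat K, tendsto_iff_dist_tendsto_zero]
  refine squeeze_zero (fun _ => dist_nonneg) hpow ?_
  have := tendsto_pow_atTop_nhds_zero_of_lt_one (inv_pos.2 hφ).le
    (inv_lt_one_of_one_lt₀ Real.one_lt_goldenRatio)
  simpa using this.mul_const _

/-- No value of `rOne α` lies strictly between `γ` and `2`; the lower bound and both equality
criteria follow from this gap. -/
theorem rOne_dichotomy : (coeffLimsup α = 1 ∧ rOne α = ENNReal.ofReal Real.goldenRatio) ∨
    (2 ≤ coeffLimsup α ∧ 2 ≤ rOne α) := by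
  by_cases h : ∃ᶠ k in atTop, 2 ≤ cfCoeff α (k + 1)
  · right
    have : 2 ≤ coeffLimsup α := by
      rw [coeffLimsup_eq]
      exact le_limsup_of_frequently_le' (h.mono fun k hk => by exact_mod_cast hk)
    exact ⟨this, this.trans (coeffLimsup_le_rOne hirr hα)⟩
  · left
    have h' : ∀ᶠ k in atTop, cfCoeff α (k + 1) = 1 := by
      filter_upwards [not_frequently.1 h] with k hk
      have := cfCoeff_succ_pos hirr hα k
      omega
    constructor
    · rw [coeffLimsup_eq, limsup_congr (v := fun _ => (1 : ENNReal)) (h'.mono fun k hk => by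
        simp [hk]), limsup_const]
    · have := ENNReal.tendsto_ofReal (tendsto_ratio_of_eventually_eq_one hirr hα h')
      rw [← this.limsup_eq, rOne]
      congr 1
      ext1 k
      rw [ENNReal.ofReal_div_of_pos (by exact_mod_cast cfDen_pos hirr hα k), ENNReal.ofReal_natCast,
        ENNReal.ofReal_natCast]

omit hirr hα in
theorem ofReal_goldenRatio_lt_two : ENNReal.ofReal Real.goldenRatio < 2 := by
  rw [show (2 : ENNReal) = ENNReal.ofReal 2 by simp]
  exact (ENNReal.ofReal_lt_ofReal_iff (by norm_num)).2 Real.goldenRatio_lt_two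

omit hirr hα in
theorem ofReal_goldenRatio_zpow :
    ENNReal.ofReal (Real.goldenRatio ^ (-2 : ℤ)) = (ENNReal.ofReal Real.goldenRatio + 1)⁻¹ := by
  have h0 := Real.goldenRatio_pos
  rw [← ENNReal.ofReal_one, ← ENNReal.ofReal_add h0.le zero_le_one,
    ← ENNReal.ofReal_inv_of_pos (by linarith), ← Real.goldenRatio_sq, zpow_neg]
  norm_cast

theorem ofReal_goldenRatio_le_rOne : ENNReal.ofReal Real.goldenRatio ≤ rOne α := by
  rcases rOne_dichotomy hirr hα with ⟨-, h⟩ | ⟨-, h⟩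
  · exact h.ge
  · exact ofReal_goldenRatio_lt_two.le.trans h

theorem rOne_eq_goldenRatio_iff :
    rOne α = ENNReal.ofReal Real.goldenRatio ↔ coeffLimsup α = 1 := by
  rcases rOne_dichotomy hirr hα with ⟨h, h'⟩ | ⟨h, h'⟩
  · exact iff_of_true h' h
  · exact iff_of_false (ofReal_goldenRatio_lt_two.trans_le h').ne'
      (lt_of_lt_of_le (by norm_num) h).ne'

theorem constants_of_not_bddAbove (h : ¬ BddAbove (Set.range (cfCoeff α))) :
    rZero α = 0 ∧ rOne α = ⊤ := by
  have h1 := rOne_eq_top hirr hα h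
  exact ⟨by rw [rZero_eq_inv hirr hα, h1]; simp, h1⟩

theorem constants_bounds :
    1 / (coeffLimsup α + 2) ≤ rZero α ∧
    rZero α ≤ ENNReal.ofReal (Real.goldenRatio ^ (-2 : ℤ)) ∧
    ENNReal.ofReal (Real.goldenRatio ^ (-2 : ℤ)) < ENNReal.ofReal Real.goldenRatio ∧
    ENNReal.ofReal Real.goldenRatio ≤ rOne α ∧
    rOne α ≤ coeffLimsup α + 1 ∧
    (rOne α = ENNReal.ofReal Real.goldenRatio ↔ coeffLimsup α = 1) ∧
    (rZero α = ENNReal.ofReal (Real.goldenRatio ^ (-2 : ℤ)) ↔ coeffLimsup α = 1) := by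
  have h1 := rOne_le hirr hα
  have h2 := ofReal_goldenRatio_le_rOne hirr hα
  have h3 := rOne_eq_goldenRatio_iff hirr hα
  refine ⟨?_, ?_, ?_, h2, h1, h3, ?_⟩
  · rw [rZero_eq_inv hirr hα, one_div, ENNReal.inv_le_inv, ← one_add_one_eq_two, ← add_assoc]
    gcongr
  · rw [rZero_eq_inv hirr hα, ofReal_goldenRatio_zpow, ENNReal.inv_le_inv]
    gcongr
  · refine (ENNReal.ofReal_lt_ofReal_iff Real.goldenRatio_pos).2 ?_
    refine lt_trans ?_ Real.one_lt_goldenRatio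
    exact zpow_lt_one_of_neg₀ Real.one_lt_goldenRatio (by norm_num)
  · rw [rZero_eq_inv hirr hα, ofReal_goldenRatio_zpow, inv_inj,
      ENNReal.add_left_inj ENNReal.one_ne_top, h3]

end Constants

/-! ### Bounds for the local return rates -/

section Rates

theorem eventually_exists_between {f : ℕ → ℕ} (hf : Monotone f) (hf' : Tendsto f atTop atTop)
    (K : ℕ) : ∀ᶠ n in atTop, ∃ k ≥ K, f k ≤ n ∧ n < f (k + 1) := by
  filter_upwards [eventually_ge_atTop (f K)] with n hn
  have hex : ∃ k, n < f k := (hf'.eventually_gt_atTop n).exists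
  have hK : K < Nat.find hex := by
    by_contra! h
    have := hf h
    have := Nat.find_spec hex
    omega
  obtain ⟨k, hk⟩ : ∃ k, Nat.find hex = k + 1 := ⟨Nat.find hex - 1, by omega⟩
  exact ⟨k, by omega, not_lt.1 (Nat.find_min hex (by omega)), hk ▸ Nat.find_spec hex⟩

variable {α : ℝ} (hirr : Irrational α) (hα : α ∈ Set.Ioo (0 : ℝ) 1)
include hirr hα

theorem rZero_le_lowerRate (x : sturmian α) : rZero α ≤ lowerRate (mapsTo_shift α) x := by
  refine le_of_forall_lt fun c hc => ?_
  obtain ⟨d, hcd, hd⟩ := exists_between hc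
  refine hcd.trans_le (le_liminf_of_le (by isBoundedDefault) ?_)
  obtain ⟨K, hK⟩ := eventually_atTop.1 (eventually_lt_of_lt_liminf hd)
  have hmono : Monotone fun k => cfDen α (k + 1) + cfDen α k := fun a b hab =>
    Nat.add_le_add (cfDen_mono hirr hα (Nat.succ_le_succ hab)) (cfDen_mono hirr hα hab)
  have htend : Tendsto (fun k => cfDen α (k + 1) + cfDen α k) atTop atTop :=
    tendsto_atTop_mono (fun k => Nat.le_add_left _ _) (tendsto_cfDen hirr hα)
  -- It is `n + 1` that is placed between consecutive sums, to match the hypothesis of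
  -- `cfDen_le_cylReturn`.
  filter_upwards [(tendsto_add_atTop_nat 1).eventually (eventually_exists_between hmono htend K)]
    with n hn
  obtain ⟨k, hk, h1, h2⟩ := hn
  refine (hK (k + 1) (by omega)).le.trans ?_
  have h3 := cfDen_le_cylReturn (x := x.1) hα hirr h1
  refine ENNReal.div_le_div ?_ ?_
  · exact_mod_cast h3
  · have : n ≤ cfDen α (k + 1 + 1) + cfDen α (k + 1) - 1 := by omega
    have h4 : (n : ENNReal) ≤ (cfDen α (k + 1 + 1) + cfDen α (k + 1) - 1 : ℕ) := by
      exact_mod_cast this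
    simpa using h4

theorem upperRate_le_rOne (x : sturmian α) : upperRate (mapsTo_shift α) x ≤ rOne α := by
  refine le_of_forall_gt fun c hc => ?_
  obtain ⟨d, hd, hdc⟩ := exists_between hc
  refine lt_of_le_of_lt (limsup_le_of_le (by isBoundedDefault) ?_) hdc
  obtain ⟨K, hK⟩ := eventually_atTop.1 (eventually_lt_of_limsup_lt hd)
  filter_upwards [eventually_exists_between (cfDen_mono hirr hα) (tendsto_cfDen hirr hα) K]
    with n hn
  obtain ⟨k, hk, h1, h2⟩ := hn
  refine le_trans ?_ (hK k hk).le
  have h3 := cylReturn_le_cfDen hα hirr x.2 h2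
  refine ENNReal.div_le_div ?_ (by exact_mod_cast h1)
  exact_mod_cast h3

omit hirr hα in
theorem lowerRate_le_upperRate (x : sturmian α) :
    lowerRate (mapsTo_shift α) x ≤ upperRate (mapsTo_shift α) x :=
  liminf_le_limsup

end Rates

/-! ### Coding of the circle -/

instance : IsProbabilityMeasure (volume : Measure UnitAddCircle) := ⟨UnitAddCircle.measure_univ⟩

/-- The representative in `[0, 1)` of a point of the circle. -/
noncomputable def circleRep (z : UnitAddCircle) : ℝ := (AddCircle.equivIco 1 0 z : ℝ)

theorem coe_circleRep (z : UnitAddCircle) : (circleRep z : UnitAddCircle) = z :=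
  AddCircle.coe_equivIco

theorem circleRep_coe (t : ℝ) : circleRep (t : UnitAddCircle) = Int.fract t := by
  have := AddCircle.coe_equivIco_mk_apply (1 : ℝ) t
  rw [div_one, mul_one] at this
  exact this

theorem measurable_circleRep : Measurable circleRep :=
  measurable_subtype_coe.comp (AddCircle.measurableEquivIco 1 0).measurable

theorem circle_induction {P : UnitAddCircle → Prop} (h : ∀ t : ℝ, P t) (z : UnitAddCircle) :
    P z := by
  rw [← coe_circleRep z]
  exact h _

theorem coe_intFract (t : ℝ) : ((Int.fract t : ℝ) : UnitAddCircle) = t := by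
  rw [← circleRep_coe, coe_circleRep]

theorem measurable_code (α : ℝ) (k : ℕ) : Measurable fun t : ℝ => code α t k := by
  refine Measurable.ite ?_ measurable_const measurable_const
  exact measurableSet_eq_fun (Int.measurable_floor.comp (measurable_id.add_const _))
    (Int.measurable_floor.comp (measurable_id.add_const _))

section CircleCode

variable {α : ℝ} (hα : α ∈ Set.Ioo (0 : ℝ) 1)

/-- The itinerary of a point of the circle, as a point of the Sturmian shift. -/
noncomputable def circleCode (z : UnitAddCircle) : sturmian α :=
  ⟨code α (circleRep z), code_mem_sturmian hα _⟩

theorem circleCode_coe (t : ℝ) : (circleCode hα (t : UnitAddCircle) : ℕ → Fin 2) = code α t := by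
  change code α (circleRep t) = _
  rw [circleRep_coe, code_fract]

theorem measurable_circleCode : Measurable (circleCode hα) := by
  refine Measurable.subtype_mk (measurable_pi_lambda _ fun k => ?_)
  exact (measurable_code α k).comp measurable_circleRep

theorem sturmianMap_circleCode (z : UnitAddCircle) :
    sturmianMap α (circleCode hα z) = circleCode hα (z + (α : UnitAddCircle)) := by
  induction z using circle_induction with
  | h t =>
    ext1
    rw [← AddCircle.coe_add, circleCode_coe]
    change shift (circleCode hα (t : UnitAddCircle)).1 = _
    rw [circleCode_coe]
    ext1 k
    have := code_add_mul α t 1 k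
    rw [Nat.cast_one, one_mul, add_comm 1 k] at this
    exact this.symm

theorem measurable_sturmianMap : Measurable (sturmianMap α) := by
  refine Measurable.subtype_mk (measurable_pi_lambda _ fun k => ?_)
  exact (measurable_pi_apply (k + 1)).comp measurable_subtype_coe

/-- The image of Lebesgue measure under the coding of the rotation. -/
noncomputable def sturmianMeasure : Measure (sturmian α) :=
  (volume : Measure UnitAddCircle).map (circleCode hα)

instance : IsProbabilityMeasure (sturmianMeasure hα) :=
  Measure.isProbabilityMeasure_map (measurable_circleCode hα).aemeasurable

theorem measurePreserving_sturmianMap :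
    MeasurePreserving (sturmianMap α) (sturmianMeasure hα) (sturmianMeasure hα) := by
  refine ⟨measurable_sturmianMap, ?_⟩
  have h1 : sturmianMap α ∘ circleCode hα = circleCode hα ∘ (· + (α : UnitAddCircle)) :=
    funext (sturmianMap_circleCode hα)
  rw [sturmianMeasure, Measure.map_map measurable_sturmianMap (measurable_circleCode hα), h1,
    ← Measure.map_map (measurable_circleCode hα) (measurable_add_const _),
    (measurePreserving_add_right volume (α : UnitAddCircle)).map_eq]

end CircleCode

/-! ### Unique ergodicity -/

/-- A probability measure on the circle which is invariant under an irrational rotation is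
Lebesgue measure. -/
theorem eq_volume_of_measurePreserving_add {α : ℝ} (hirr : Irrational α)
    (μ : Measure UnitAddCircle) [IsProbabilityMeasure μ]
    (h : MeasurePreserving (fun z => (α : UnitAddCircle) + z) μ μ) : μ = volume := by
  -- The translations preserving `μ` form a subgroup, dense because it contains `α`. Integrals of
  -- continuous functions depend continuously on the translation, so `μ` is invariant under all of
  -- them, and Haar measure is unique.
  let S : AddSubgroup UnitAddCircle :=
    { carrier := {g | MeasurePreserving (fun z => g + z) μ μ}
      zero_mem' := by
        have : (fun z : UnitAddCircle => 0 + z) = id := funext zero_add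
        rw [Set.mem_ofPred_eq, this]
        exact MeasurePreserving.id μ
      add_mem' := fun {a b} ha hb => by
        have := MeasurePreserving.comp ha hb
        simpa [Function.comp_def, add_assoc] using this
      neg_mem' := fun {a} ha => by
        exact MeasurePreserving.symm (MeasurableEquiv.addLeft a) ha }
  have hdense : Dense (S : Set UnitAddCircle) := by
    have h1 : DenseRange fun n : ℤ => n • (α : UnitAddCircle) :=
      AddCircle.denseRange_zsmul_coe_iff.2 (by simpa using hirr)
    refine h1.mono ?_
    rintro _ ⟨n, rfl⟩
    exact S.zsmul_mem h n
  have hinv : ∀ (f : BoundedContinuousFunction UnitAddCircle ℝ) (g : UnitAddCircle),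
      ∫ z, f (g + z) ∂μ = ∫ z, f z ∂μ := by
    intro f
    have hc : Continuous fun g : UnitAddCircle => ∫ z, f (g + z) ∂μ := by
      refine continuous_of_dominated (bound := fun _ => ‖f‖) (fun g => ?_) (fun g => ?_)
        (integrable_const _) ?_
      · exact (f.continuous.comp (continuous_const.add continuous_id)).aestronglyMeasurable
      · exact Eventually.of_forall fun z => f.norm_coe_le_norm _
      · exact Eventually.of_forall fun z =>
          f.continuous.comp (continuous_id.add continuous_const)
    have hcl : IsClosed {g : UnitAddCircle | ∫ z, f (g + z) ∂μ = ∫ z, f z ∂μ} :=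
      isClosed_eq hc continuous_const
    have hsub : (S : Set UnitAddCircle) ⊆ {g | ∫ z, f (g + z) ∂μ = ∫ z, f z ∂μ} := by
      intro g hg
      exact MeasurePreserving.integral_comp hg (MeasurableEquiv.addLeft g).measurableEmbedding f
    intro g
    have := hcl.closure_subset_iff.2 hsub
    rw [hdense.closure_eq] at this
    exact this (Set.mem_univ g)
  have hleft : μ.IsAddLeftInvariant := by
    refine ⟨fun g => ?_⟩
    have : IsProbabilityMeasure (μ.map (g + ·)) :=
      Measure.isProbabilityMeasure_map (measurable_const_add g).aemeasurable
    refine ext_of_forall_integral_eq_of_IsFiniteMeasure fun f => ?_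
    rw [integral_map (measurable_const_add g).aemeasurable f.continuous.aestronglyMeasurable]
    exact hinv f g
  have h2 := Measure.isAddLeftInvariant_eq_smul μ (volume : Measure UnitAddCircle)
  have h3 := congrArg (fun ν => ν Set.univ) h2
  simp only [measure_univ, Measure.smul_apply] at h3
  rw [h2]
  have h4 : μ.addHaarScalarFactor (volume : Measure UnitAddCircle) = 1 := by
    have : ((μ.addHaarScalarFactor (volume : Measure UnitAddCircle) : NNReal) : ENNReal) = 1 := by
      rw [h3, ENNReal.smul_def, smul_eq_mul, mul_one]
    exact_mod_cast this
  rw [h4, one_smul]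

section UniqueErgodicity

variable {α : ℝ} (hirr : Irrational α) (hα : α ∈ Set.Ioo (0 : ℝ) 1)
include hirr hα

/-- Points coding longer and longer prefixes of `x` converge to a limit depending on `x`. -/
theorem exists_measurable_limit : ∃ f : sturmian α → ℝ, Measurable f ∧
    ∀ (x : sturmian α) (s : ℕ → ℝ), (∀ n, s n ∈ Set.Ico (0 : ℝ) 1) →
      (∀ n, ∀ k < n, code α (s n) k = x.1 k) → Tendsto s atTop (nhds (f x)) := by
  classical
  let T : (n : ℕ) → (Fin n → Fin 2) → ℝ := fun n u =>
    if h : (codingInterval α u).Nonempty then h.some else 0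
  let t : ℕ → sturmian α → ℝ := fun n x => T n (pre x.1 n)
  have ht : ∀ (x : sturmian α) n, t n x ∈ Set.Ico (0 : ℝ) 1 ∧
      ∀ k < n, code α (t n x) k = x.1 k := by
    intro x n
    have h1 : t n x ∈ codingInterval α (pre x.1 n) := by
      have : t n x = (x.2 n).some := dif_pos (x.2 n)
      rw [this]
      exact (x.2 n).some_mem
    obtain ⟨h2, h3⟩ := (mem_codingInterval_iff hα _ _).1 h1
    exact ⟨h2, fun k hk => h3 ⟨k, hk⟩⟩
  have htm : ∀ n, Measurable (t n) := by
    intro n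
    have h1 : Measurable (T n) := Measurable.of_discrete
    refine h1.comp (measurable_pi_lambda _ fun i => ?_)
    exact (measurable_pi_apply (i : ℕ)).comp measurable_subtype_coe
  -- This makes the chosen points a Cauchy sequence and the limit independent of the choice.
  have hclose : ∀ ε > 0, ∃ N, ∀ a ∈ Set.Ico (0 : ℝ) 1, ∀ b ∈ Set.Ico (0 : ℝ) 1,
      (∀ i < N, code α a i = code α b i) → |b - a| < ε := by
    intro ε hε
    obtain ⟨k, hk⟩ := ((tendsto_abs_cfErr hirr hα).eventually_lt_const hε).exists
    exact ⟨cfDen α (k + 1) + cfDen α k, fun a ha b hb h =>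
      (abs_sub_lt_of_code_eq hα hirr (Nat.le_succ _) ha hb h).trans hk⟩
  have hlim : ∀ x, ∃ l, Tendsto (fun n => t n x) atTop (nhds l) := by
    intro x
    refine cauchySeq_tendsto_of_complete (Metric.cauchySeq_iff'.2 fun ε hε => ?_)
    obtain ⟨N, hN⟩ := hclose ε hε
    refine ⟨N, fun n hn => hN _ (ht x N).1 _ (ht x n).1 fun i hi => ?_⟩
    rw [(ht x N).2 i hi, (ht x n).2 i (by omega)]
  choose f hf using hlim
  refine ⟨f, measurable_of_tendsto_metrizable htm (tendsto_pi_nhds.2 hf), fun x s hs hs' => ?_⟩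
  have h0 : Tendsto (fun n => s n - t n x) atTop (nhds 0) := by
    refine Metric.tendsto_atTop.2 fun ε hε => ?_
    obtain ⟨N, hN⟩ := hclose ε hε
    refine ⟨N, fun n hn => ?_⟩
    rw [Real.dist_eq, sub_zero]
    refine hN _ (ht x n).1 _ (hs n) fun i hi => ?_
    rw [(ht x n).2 i (by omega), hs' n i (by omega)]
  simpa using h0.add (hf x)

omit hirr hα in
theorem eventually_floor_eq {s : ℕ → ℝ} {y : ℝ} (hs : Tendsto s atTop (nhds y))
    (hy : ∀ l : ℤ, y ≠ l) : ∀ᶠ n in atTop, ⌊s n⌋ = ⌊y⌋ := by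
  have h1 : (⌊y⌋ : ℝ) < y := lt_of_le_of_ne (Int.floor_le y) (hy _).symm
  filter_upwards [hs.eventually_const_lt h1, hs.eventually_lt_const (Int.lt_floor_add_one y)]
    with n h2 h3
  exact Int.floor_eq_iff.2 ⟨h2.le, h3⟩

/-- The factor map is the limit point modulo `1`. Away from the points `-jα` every floor is locally
constant there, so the code of the limit is the limit of the codes. -/
theorem exists_measurable_factor : ∃ p : sturmian α → UnitAddCircle, Measurable p ∧
    (∀ x, p (sturmianMap α x) = (α : UnitAddCircle) + p x) ∧
    ∀ x, (∀ j : ℕ, p x ≠ ((-(j * α) : ℝ) : UnitAddCircle)) → circleCode hα (p x) = x := by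
  obtain ⟨f, hf, hlim⟩ := exists_measurable_limit hirr hα
  refine ⟨fun x => (f x : UnitAddCircle), AddCircle.measurable_mk'.comp hf, fun x => ?_,
    fun x hx => ?_⟩
  · choose s hs hs' using fun n => exists_code_eq hα x.2 (n + 1)
    have h1 : Tendsto s atTop (nhds (f x)) :=
      hlim x s hs fun n k hk => hs' n k (by omega)
    have h2 : Tendsto (fun n => Int.fract (s n + α)) atTop (nhds (f (sturmianMap α x))) := by
      refine hlim _ _ (fun n => ⟨Int.fract_nonneg _, Int.fract_lt_one _⟩) fun n k hk => ?_
      have h3 := code_add_mul α (s n) 1 k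
      rw [Nat.cast_one, one_mul, add_comm 1 k] at h3
      rw [code_fract, h3]
      exact hs' n (k + 1) (by omega)
    have hcont : Continuous ((↑) : ℝ → UnitAddCircle) := AddCircle.continuous_mk' 1
    have h3 := (hcont.tendsto _).comp h2
    have h4 := (hcont.tendsto _).comp (h1.add_const α)
    have h5 : ((↑) : ℝ → UnitAddCircle) ∘ (fun n => Int.fract (s n + α)) =
        ((↑) : ℝ → UnitAddCircle) ∘ (fun n => s n + α) := funext fun n => coe_intFract _
    rw [h5] at h3
    have h6 := tendsto_nhds_unique h3 h4
    rw [AddCircle.coe_add, add_comm] at h6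
    exact h6
  · choose s hs hs' using fun n => exists_code_eq hα x.2 n
    have h1 : Tendsto s atTop (nhds (f x)) := hlim x s hs hs'
    have hne : ∀ (j : ℕ) (l : ℤ), f x + j * α ≠ l := by
      intro j l hl
      refine hx j ?_
      have : f x = -(j * α) + l := by linarith
      change ((f x : ℝ) : UnitAddCircle) = _
      rw [this, AddCircle.coe_add]
      simp
    ext k
    rw [circleCode_coe]
    have h2 := eventually_floor_eq (h1.add_const (k * α)) (hne k)
    have h3 := eventually_floor_eq (h1.add_const ((k + 1 : ℕ) * α)) (hne (k + 1))
    obtain ⟨n, h4, h5, h6⟩ := (h2.and (h3.and (eventually_gt_atTop k))).exists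
    rw [← hs' n k h6, code, code, h4, h5]

omit hirr hα in
theorem volume_countable_eq_zero {s : Set UnitAddCircle} (hs : s.Countable) : volume s = 0 := by
  rw [← Set.biUnion_of_singleton s]
  refine (measure_biUnion_null_iff hs).2 fun x _ => ?_
  have h := AddCircle.volume_closedBall (1 : ℝ) (x := x) 0
  simpa using h

/-- The image of `ν` on the circle is Lebesgue measure, for which the countable exceptional set is
null; hence coding after projection is `ν`-almost everywhere the identity. -/
theorem eq_sturmianMeasure (ν : Measure (sturmian α)) [IsProbabilityMeasure ν]
    (hν : MeasurePreserving (sturmianMap α) ν ν) : ν = sturmianMeasure hα := by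
  obtain ⟨p, hp, hpσ, hpc⟩ := exists_measurable_factor hirr hα
  have : IsProbabilityMeasure (ν.map p) := Measure.isProbabilityMeasure_map hp.aemeasurable
  have h1 : ν.map p = volume := by
    refine eq_volume_of_measurePreserving_add hirr _ ⟨measurable_const_add _, ?_⟩
    have h2 : (fun z => (α : UnitAddCircle) + z) ∘ p = p ∘ sturmianMap α :=
      funext fun x => (hpσ x).symm
    rw [Measure.map_map (measurable_const_add _) hp, h2,
      ← Measure.map_map hp measurable_sturmianMap, hν.map_eq]
  have h3 : ∀ᵐ z ∂(ν.map p), z ∉ Set.range fun j : ℕ => ((-(j * α) : ℝ) : UnitAddCircle) := by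
    rw [h1]
    exact measure_eq_zero_iff_ae_notMem.1 (volume_countable_eq_zero (Set.countable_range _))
  have h4 : ∀ᵐ x ∂ν, circleCode hα (p x) = x := by
    filter_upwards [ae_of_ae_map hp.aemeasurable h3] with x hx
    exact hpc x fun j hj => hx ⟨j, hj.symm⟩
  calc ν = ν.map id := Measure.map_id.symm
    _ = ν.map (circleCode hα ∘ p) := Measure.map_congr (h4.mono fun x hx => hx.symm)
    _ = sturmianMeasure hα := by
      rw [← Measure.map_map (measurable_circleCode hα) hp, h1, sturmianMeasure]

end UniqueErgodicity

/-! ### Almost sure values of the return rates -/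

section Ergodic

variable {α : ℝ} (hirr : Irrational α)
include hirr

theorem ergodic_add_coe :
    Ergodic (fun z : UnitAddCircle => z + (α : UnitAddCircle)) volume := by
  rw [AddCircle.ergodic_add_right, ← AddCircle.denseRange_zsmul_iff,
    AddCircle.denseRange_zsmul_coe_iff]
  simpa using hirr

/-- Inclusion in one direction suffices for ergodicity, and it is all that is available: the rates
are only shown not to increase under the shift. -/
theorem ae_mem_of_subset_preimage {s : Set UnitAddCircle} (hs : MeasurableSet s)
    (h : ∀ z ∈ s, z + (α : UnitAddCircle) ∈ s) (h0 : volume s ≠ 0) : ∀ᵐ z, z ∈ s := by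
  rcases (ergodic_add_coe hirr).ae_empty_or_univ_of_ae_le_preimage hs.nullMeasurableSet
    (Eventually.of_forall h) with h1 | h1
  · exact absurd (measure_eq_zero_iff_ae_notMem.2 (eventuallyEq_empty.1 h1)) h0
  · exact eventuallyEq_univ.1 h1

theorem ae_mem_of_preimage_subset {s : Set UnitAddCircle} (hs : MeasurableSet s)
    (h : ∀ z : UnitAddCircle, z + (α : UnitAddCircle) ∈ s → z ∈ s) (h0 : volume s ≠ 0) :
    ∀ᵐ z, z ∈ s := by
  rcases (ergodic_add_coe hirr).ae_empty_or_univ_of_preimage_ae_le hs.nullMeasurableSet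
    (Eventually.of_forall h) with h1 | h1
  · exact absurd (measure_eq_zero_iff_ae_notMem.2 (eventuallyEq_empty.1 h1)) h0
  · exact eventuallyEq_univ.1 h1

end Ergodic

/-- The limsup set is a decreasing intersection of tail unions, each of measure at least `c`. -/
theorem le_measure_frequently {X : Type*} [MeasurableSpace X] (μ : Measure X) [IsFiniteMeasure μ]
    {E : ℕ → Set X} (hE : ∀ k, MeasurableSet (E k)) {c : ENNReal}
    (h : ∃ᶠ k in atTop, c ≤ μ (E k)) : c ≤ μ {x | ∃ᶠ k in atTop, x ∈ E k} := by
  have h1 : {x | ∃ᶠ k in atTop, x ∈ E k} = ⋂ n : ℕ, ⋃ k ≥ n, E k := by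
    ext x
    simp [frequently_atTop]
  rw [h1]
  refine ge_of_tendsto' (tendsto_measure_iInter_atTop (μ := μ) (s := fun n : ℕ => ⋃ k ≥ n, E k)
    (fun n => (MeasurableSet.biUnion (Set.to_countable _) fun k _ => hE k).nullMeasurableSet)
    (fun a b hab => Set.biUnion_subset_biUnion_left fun k hk => le_trans hab hk)
    ⟨0, measure_ne_top _ _⟩) fun n => ?_
  obtain ⟨k, hk, hk'⟩ := frequently_atTop.1 h n
  exact hk'.trans (measure_mono (Set.subset_biUnion_of_mem (u := fun k => E k) hk))

/-! ### Monotonicity of the rates under the shift, and their measurability -/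

section Subinvariance

variable {α : ℝ}

/-- Dropping the first letter of a returning point leaves a returning point. -/
theorem cylReturn_shift_le (x : ℕ → Fin 2) (n : ℕ) :
    cylReturn α (shift x) n ≤ cylReturn α x (n + 1) := by
  refine le_cylReturn_of_mem fun m y hy hm h1 h2 => ?_
  exact cylReturn_le_of_mem hm (mapsTo_shift α hy) (fun k hk => h1 (k + 1) (by omega))
    fun k hk => h2 (k + 1) (by omega)

theorem div_natCast_eq_mul (a : ENNReal) {n : ℕ} (hn : 0 < n) :
    a / n = a / (n + 1 : ℕ) * (1 + (n : ENNReal)⁻¹) := by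
  have h1 : (n : ENNReal) ≠ 0 := Nat.cast_ne_zero.2 hn.ne'
  have h2 : ((n + 1 : ℕ) : ENNReal) ≠ 0 := Nat.cast_ne_zero.2 n.succ_ne_zero
  have h3 : 1 + (n : ENNReal)⁻¹ = (n + 1 : ℕ) * (n : ENNReal)⁻¹ := by
    push_cast
    rw [add_mul, one_mul, ENNReal.mul_inv_cancel h1 (ENNReal.natCast_ne_top _)]
  rw [h3, div_eq_mul_inv, div_eq_mul_inv, mul_assoc, ← mul_assoc _ _ (n : ENNReal)⁻¹,
    ENNReal.inv_mul_cancel h2 (ENNReal.natCast_ne_top _), one_mul]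

theorem tendsto_one_add_inv_natCast :
    Tendsto (fun n : ℕ => 1 + (n : ENNReal)⁻¹) atTop (nhds 1) := by
  simpa using ENNReal.tendsto_inv_nat_nhds_zero.const_add 1

theorem eventually_shift_div_le (x : ℕ → Fin 2) : ∀ᶠ n : ℕ in atTop,
    ((cylReturn α (shift x) n : ℕ∞) : ENNReal) / n ≤
      ((fun n : ℕ => ((cylReturn α x (n + 1) : ℕ∞) : ENNReal) / (n + 1 : ℕ)) *
        fun n : ℕ => 1 + (n : ENNReal)⁻¹) n := by
  filter_upwards [eventually_gt_atTop 0] with n hn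
  rw [Pi.mul_apply, ← div_natCast_eq_mul _ hn]
  gcongr
  exact_mod_cast cylReturn_shift_le x n

theorem upperRate_shift_le (x : sturmian α) :
    upperRate (mapsTo_shift α) (sturmianMap α x) ≤ upperRate (mapsTo_shift α) x := by
  refine (limsup_le_limsup (eventually_shift_div_le x.1)).trans ?_
  have h1 := tendsto_one_add_inv_natCast.limsup_eq
  refine (ENNReal.limsup_mul_le' (by simp [h1]) (by simp [h1])).trans ?_
  rw [h1, mul_one]
  exact (limsup_nat_add (fun n : ℕ => ((cylReturn α x.1 n : ℕ∞) : ENNReal) / n) 1).le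

theorem lowerRate_shift_le (x : sturmian α) :
    lowerRate (mapsTo_shift α) (sturmianMap α x) ≤ lowerRate (mapsTo_shift α) x := by
  refine (liminf_le_liminf (eventually_shift_div_le x.1)).trans ?_
  have h1 := tendsto_one_add_inv_natCast.limsup_eq
  rw [mul_comm]
  refine (ENNReal.liminf_mul_le (by simp [h1]) (by simp [h1])).trans ?_
  rw [h1, one_mul]
  exact (liminf_nat_add (fun n : ℕ => ((cylReturn α x.1 n : ℕ∞) : ENNReal) / n) 1).le

theorem measurable_cylReturn_div (n : ℕ) : Measurable fun x : sturmian α =>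
    ((cylReturn α x.1 n : ℕ∞) : ENNReal) / n := by
  have h1 : Measurable fun u : Fin n → Fin 2 =>
      ((returnTime ((mapsTo_shift α).restrict shift (sturmian α) (sturmian α))
        (cylinder (sturmian α) u) : ℕ∞) : ENNReal) / n := Measurable.of_discrete
  refine h1.comp (measurable_pi_lambda (fun x : sturmian α => pre x.1 n) fun i => ?_)
  exact (measurable_pi_apply (i : ℕ)).comp measurable_subtype_coe

theorem measurable_upperRate : Measurable (upperRate (mapsTo_shift α)) :=
  Measurable.limsup measurable_cylReturn_div

theorem measurable_lowerRate : Measurable (lowerRate (mapsTo_shift α)) :=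
  Measurable.liminf measurable_cylReturn_div

end Subinvariance

/-! ### Arcs of the circle -/

/-- The arc between `-jα` and `-jα - D`. -/
def rotatedArc (α D : ℝ) (j : ℕ) : Set UnitAddCircle :=
  {z | ⌊circleRep z + j * α + D⌋ ≠ ⌊circleRep z + j * α⌋}

section Arcs

variable {α D : ℝ}

theorem measurableSet_rotatedArc (j : ℕ) : MeasurableSet (rotatedArc α D j) := by
  have h : Measurable fun z => circleRep z + j * α := measurable_circleRep.add_const _
  exact (measurableSet_eq_fun (Int.measurable_floor.comp (h.add_const D))
    (Int.measurable_floor.comp h)).compl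

theorem coe_mem_rotatedArc_iff (t : ℝ) (j : ℕ) :
    (t : UnitAddCircle) ∈ rotatedArc α D j ↔ ⌊t + j * α + D⌋ ≠ ⌊t + j * α⌋ := by
  change ⌊circleRep t + j * α + D⌋ ≠ ⌊circleRep t + j * α⌋ ↔ _
  have e1 : Int.fract t + j * α + D = t + j * α + D - (⌊t⌋ : ℤ) := by
    rw [Int.fract]; ring
  have e2 : Int.fract t + j * α = t + j * α - (⌊t⌋ : ℤ) := by
    rw [Int.fract]; ring
  rw [circleRep_coe, e1, e2, Int.floor_sub_intCast, Int.floor_sub_intCast]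
  omega

theorem le_volume_rotatedArc_zero (hD : |D| < 1) :
    ENNReal.ofReal |D| ≤ volume (rotatedArc α D 0) := by
  rw [← (UnitAddCircle.measurePreserving_mk 0).measure_preimage
    (measurableSet_rotatedArc 0).nullMeasurableSet, Measure.restrict_apply
      ((UnitAddCircle.measurePreserving_mk 0).measurable (measurableSet_rotatedArc 0))]
  rw [abs_lt] at hD
  rcases le_or_gt 0 D with h | h
  · have h1 : volume (Set.Ico (1 - D) 1) = ENNReal.ofReal |D| := by
      rw [Real.volume_Ico, abs_of_nonneg h]; congr 1; ring
    rw [← h1]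
    refine measure_mono fun t ht => ⟨(coe_mem_rotatedArc_iff t 0).2 ?_, ?_⟩
    · have h2 : ⌊t⌋ = 0 := Int.floor_eq_zero_iff.2 ⟨by linarith [ht.1], ht.2⟩
      have h3 : 1 ≤ ⌊t + D⌋ := Int.le_floor.2 (by push_cast; linarith [ht.1])
      simp only [Nat.cast_zero, zero_mul, add_zero]
      omega
    · exact ⟨by linarith [ht.1], by linarith [ht.2]⟩
  -- The circle is parametrized here by `(0, 1]`, so the endpoint `0` of the arc is left out.
  · have h1 : volume (Set.Ioo 0 (-D)) = ENNReal.ofReal |D| := by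
      rw [Real.volume_Ioo, abs_of_neg h, sub_zero]
    rw [← h1]
    refine measure_mono fun t ht => ⟨(coe_mem_rotatedArc_iff t 0).2 ?_, ?_⟩
    · have h2 : ⌊t⌋ = 0 := Int.floor_eq_zero_iff.2 ⟨ht.1.le, by linarith [ht.2]⟩
      have h3 : ⌊t + D⌋ < 0 := Int.floor_lt.2 (by push_cast; linarith [ht.2])
      simp only [Nat.cast_zero, zero_mul, add_zero]
      omega
    · exact ⟨ht.1, by linarith [ht.2]⟩

theorem le_volume_rotatedArc (hD : |D| < 1) (j : ℕ) :
    ENNReal.ofReal |D| ≤ volume (rotatedArc α D j) := by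
  have h1 : rotatedArc α D j =
      (fun z => z + ((j * α : ℝ) : UnitAddCircle)) ⁻¹' rotatedArc α D 0 := by
    ext z
    induction z using circle_induction with
    | h t =>
      rw [coe_mem_rotatedArc_iff, Set.mem_preimage, ← AddCircle.coe_add, coe_mem_rotatedArc_iff]
      simp
  rw [h1, (measurePreserving_add_right volume _).measure_preimage
    (measurableSet_rotatedArc 0).nullMeasurableSet]
  exact le_volume_rotatedArc_zero hD

/-- A common point would put its rotations by `iα` and `jα` into one arc of length `|D|`, making
`‖(j - i)α‖ < |D|`. -/
theorem disjoint_rotatedArc (hD : |D| < 1) {i j : ℕ} (hij : i < j)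
    (h : ∀ l : ℤ, |D| ≤ |((j - i : ℕ) : ℝ) * α - l|) :
    Disjoint (rotatedArc α D i) (rotatedArc α D j) := by
  -- The sign of `D` decides the direction of the jump, so both rotated points jump to the same
  -- integer.
  have key : ∀ y : ℝ, ⌊y + D⌋ ≠ ⌊y⌋ → ⌊Int.fract y + D⌋ ≠ 0 ∧
      (0 ≤ D → ⌊Int.fract y + D⌋ = 1) ∧ (D ≤ 0 → ⌊Int.fract y + D⌋ = -1) := by
    intro y hy
    have e : Int.fract y + D = y + D - (⌊y⌋ : ℤ) := by rw [Int.fract]; ring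
    have h0 := Int.fract_nonneg y
    have h1 := Int.fract_lt_one y
    have h2 : ⌊Int.fract y + D⌋ ≠ 0 := by rw [e, Int.floor_sub_intCast]; omega
    rw [abs_lt] at hD
    have h3 : ⌊Int.fract y + D⌋ < 2 := Int.floor_lt.2 (by push_cast; linarith)
    have h4 : -1 ≤ ⌊Int.fract y + D⌋ := Int.le_floor.2 (by push_cast; linarith)
    refine ⟨h2, fun hD0 => ?_, fun hD0 => ?_⟩
    · have : 0 ≤ ⌊Int.fract y + D⌋ := Int.le_floor.2 (by push_cast; linarith)
      omega
    · have : ⌊Int.fract y + D⌋ < 1 := Int.floor_lt.2 (by push_cast; linarith)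
      omega
  refine Set.disjoint_left.2 fun z hz hz' => ?_
  set a := circleRep z + i * α with ha
  set b := circleRep z + j * α with hb
  obtain ⟨ha0, ha1, ha2⟩ := key a hz
  obtain ⟨hb0, hb1, hb2⟩ := key b hz'
  have h1 : ∀ y : ℝ, ⌊Int.fract y⌋ = 0 := fun y =>
    Int.floor_eq_zero_iff.2 ⟨Int.fract_nonneg y, Int.fract_lt_one y⟩
  have h2 := abs_sub_lt_of_floor_add_ne (a := Int.fract b) (b := Int.fract a) (D := D)
    (by rw [h1, h1]) (by
      rcases le_total 0 D with hD0 | hD0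
      · rw [ha1 hD0, hb1 hD0]
      · rw [ha2 hD0, hb2 hD0]) (by rwa [h1])
  have h3 := h (⌊b⌋ - ⌊a⌋)
  have h4 : Int.fract b - Int.fract a =
      ((j - i : ℕ) : ℝ) * α - ((⌊b⌋ - ⌊a⌋ : ℤ) : ℝ) := by
    rw [Int.fract, Int.fract, Nat.cast_sub hij.le, ha, hb]; push_cast; ring
  rw [← h4] at h3
  exact absurd h2 (not_lt.2 h3)

theorem le_volume_iUnion_rotatedArc (hirr : Irrational α) (hα : α ∈ Set.Ioo (0 : ℝ) 1) {k a b : ℕ}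
    (hD : |D| = |cfErr α k|) (hab : b ≤ a + cfDen α (k + 1)) :
    ENNReal.ofReal (((b : ℝ) - a) * |cfErr α k|) ≤
      volume (⋃ j ∈ Finset.Ico a b, rotatedArc α D j) := by
  have hD1 : |D| < 1 := hD ▸ abs_cfErr_lt_one hirr hα k
  have hdisj : ∀ i ∈ Finset.Ico a b, ∀ j ∈ Finset.Ico a b, i < j →
      Disjoint (rotatedArc α D i) (rotatedArc α D j) := by
    intro i hi j hj hij
    rw [Finset.mem_Ico] at hi hj
    refine disjoint_rotatedArc hD1 hij fun l => ?_
    rw [hD]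
    exact abs_cfErr_le hirr hα k (j - i) l (by omega) (by omega)
  rw [measure_biUnion_finset _ fun j _ => measurableSet_rotatedArc j]
  · refine le_trans ?_ (Finset.card_nsmul_le_sum _ _ (ENNReal.ofReal |D|)
      fun j _ => le_volume_rotatedArc hD1 j)
    rw [Nat.card_Ico, nsmul_eq_mul, ← ENNReal.ofReal_natCast,
      ← ENNReal.ofReal_mul (Nat.cast_nonneg _), hD]
    refine ENNReal.ofReal_le_ofReal (mul_le_mul_of_nonneg_right ?_ (abs_nonneg _))
    have : (b : ℝ) ≤ (b - a : ℕ) + a := by exact_mod_cast (by omega : b ≤ b - a + a)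
    linarith
  · intro i hi j hj hij
    rcases lt_or_gt_of_ne hij with h | h
    · exact hdisj i hi j hj h
    · exact (hdisj j hj i hi h).symm

end Arcs

/-! ### The rates at almost every point -/

section AlmostSure

variable {α : ℝ} (hirr : Irrational α) (hα : α ∈ Set.Ioo (0 : ℝ) 1)
include hirr

/-- Points in infinitely many `E k` satisfy the bound and have measure at least `c > 0`; ergodicity
and `upperRate_shift_le` then give the bound almost everywhere. -/
theorem ae_le_upperRate_of_frequently {v : ENNReal} {E : ℕ → Set UnitAddCircle} {n : ℕ → ℕ}
    (hE : ∀ k, MeasurableSet (E k)) (hn : Tendsto n atTop atTop) {c : ENNReal} (hc : 0 < c)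
    (hEc : ∃ᶠ k in atTop, c ≤ volume (E k))
    (h : ∀ᶠ k in atTop, ∀ z ∈ E k,
      v ≤ ((cylReturn α (circleCode hα z).1 (n k) : ℕ∞) : ENNReal) / (n k : ℕ)) :
    ∀ᵐ z, v ≤ upperRate (mapsTo_shift α) (circleCode hα z) := by
  refine ae_mem_of_preimage_subset hirr
    (s := {z | v ≤ upperRate (mapsTo_shift α) (circleCode hα z)})
    (measurableSet_le measurable_const (measurable_upperRate.comp (measurable_circleCode hα)))
    (fun z hz => ?_) ?_
  · have h1 : v ≤ upperRate (mapsTo_shift α) (circleCode hα (z + (α : UnitAddCircle))) := hz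
    rw [← sturmianMap_circleCode] at h1
    exact h1.trans (upperRate_shift_le _)
  · refine (hc.trans_le ((le_measure_frequently volume hE hEc).trans (measure_mono ?_))).ne'
    intro z hz
    rw [Set.mem_ofPred_eq, upperRate]
    refine le_limsup_of_frequently_le' (hn.frequently ?_)
    exact (Frequently.and_eventually hz h).mono fun k hk => hk.2 z hk.1

theorem ae_lowerRate_le_of_frequently {v : ENNReal} {E : ℕ → Set UnitAddCircle} {n : ℕ → ℕ}
    (hE : ∀ k, MeasurableSet (E k)) (hn : Tendsto n atTop atTop) {c : ENNReal} (hc : 0 < c)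
    (hEc : ∃ᶠ k in atTop, c ≤ volume (E k))
    (h : ∀ᶠ k in atTop, ∀ z ∈ E k,
      ((cylReturn α (circleCode hα z).1 (n k) : ℕ∞) : ENNReal) / (n k : ℕ) ≤ v) :
    ∀ᵐ z, lowerRate (mapsTo_shift α) (circleCode hα z) ≤ v := by
  refine ae_mem_of_subset_preimage hirr
    (s := {z | lowerRate (mapsTo_shift α) (circleCode hα z) ≤ v})
    (measurableSet_le (measurable_lowerRate.comp (measurable_circleCode hα)) measurable_const)
    (fun z hz => ?_) ?_
  · change lowerRate (mapsTo_shift α) (circleCode hα (z + (α : UnitAddCircle))) ≤ v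
    rw [← sturmianMap_circleCode]
    exact (lowerRate_shift_le _).trans hz
  · refine (hc.trans_le ((le_measure_frequently volume hE hEc).trans (measure_mono ?_))).ne'
    intro z hz
    rw [Set.mem_ofPred_eq, lowerRate]
    refine liminf_le_of_frequently_le' (hn.frequently ?_)
    exact (Frequently.and_eventually hz h).mono fun k hk => hk.2 z hk.1

theorem ae_le_upperRate {v : NNReal} (hv : 1 ≤ v) (hv' : (v : ENNReal) < rOne α) :
    ∀ᵐ z, (v : ENNReal) ≤ upperRate (mapsTo_shift α) (circleCode hα z) := by
  obtain ⟨w, hvw, hw⟩ := ENNReal.lt_iff_exists_nnreal_btwn.1 hv'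
  have hvw : (v : ℝ) < w := by exact_mod_cast hvw
  have hv1 : (1 : ℝ) ≤ v := by exact_mod_cast hv
  have hv0 : (0 : ℝ) < v := by linarith
  have hq : ∀ k, (1 : ℝ) ≤ cfDen α k := fun k => by exact_mod_cast cfDen_pos hirr hα k
  -- The largest length at which `τ ≥ q_{k+1}` still forces `τ / n ≥ v`. As `v ≥ 1`, it is at most
  -- `q_{k+1}`, which keeps the arcs below disjoint.
  set n : ℕ → ℕ := fun k => ⌊(cfDen α (k + 1) : ℝ) / v⌋₊ with hn
  have hnt : Tendsto n atTop atTop :=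
    tendsto_nat_floor_atTop.comp (((tendsto_natCast_atTop_atTop.comp
      ((tendsto_cfDen hirr hα).comp (tendsto_add_atTop_nat 1)))).atTop_div_const hv0)
  have hnv : ∀ k, (n k : ℝ) * v ≤ cfDen α (k + 1) := fun k =>
    (le_div_iff₀ hv0).1 (Nat.floor_le (by positivity))
  have hnq : ∀ k, n k ≤ cfDen α (k + 1) := fun k => by
    have : (n k : ℝ) ≤ cfDen α (k + 1) := by nlinarith [hnv k, Nat.cast_nonneg (α := ℝ) (n k)]
    exact_mod_cast this
  -- When `q_{k+1} / q_k > w`, there are at least `(1/v - 1/w) q_{k+1}` arcs, and `q_{k+1} ‖q_k α‖ ≥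
  -- 1/2`.
  have hc : 0 < ((v : ℝ)⁻¹ - (w : ℝ)⁻¹) / 2 := by
    have := inv_strictAnti₀ hv0 hvw
    linarith
  refine ae_le_upperRate_of_frequently hirr hα (n := n)
    (E := fun k => ⋃ j ∈ Finset.Ico 0 (n k + 1 - cfDen α k), rotatedArc α (cfErr α k) j)
    (fun k => Finset.measurableSet_biUnion _ fun j _ => measurableSet_rotatedArc j) hnt
    (ENNReal.ofReal_pos.2 hc) ?_ ?_
  · refine (frequently_lt_of_lt_limsup (by isBoundedDefault) hw).mono fun k hk => ?_
    have hk1 : (w : ℝ) * cfDen α k < cfDen α (k + 1) := by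
      have h0 : (cfDen α k : ENNReal) ≠ 0 :=
        Nat.cast_ne_zero.2 (Nat.one_le_iff_ne_zero.1 (cfDen_pos hirr hα k))
      rw [ENNReal.lt_div_iff_mul_lt (Or.inl h0) (Or.inl (ENNReal.natCast_ne_top _))] at hk
      exact_mod_cast hk
    refine le_trans (ENNReal.ofReal_le_ofReal ?_)
      (le_volume_iUnion_rotatedArc (D := cfErr α k) (a := 0) (b := n k + 1 - cfDen α k) hirr hα rfl
        (by have := hnq k; have := cfDen_pos hirr hα k; omega))
    have h1 : (cfDen α (k + 1) : ℝ) / v < n k + 1 := Nat.lt_floor_add_one _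
    have h2 : (n k : ℝ) + 1 ≤ (n k + 1 - cfDen α k : ℕ) + cfDen α k := by
      exact_mod_cast (by omega : n k + 1 ≤ n k + 1 - cfDen α k + cfDen α k)
    have h3 : (cfDen α k : ℝ) ≤ cfDen α (k + 1) * (w : ℝ)⁻¹ := by
      rw [← div_eq_mul_inv, le_div_iff₀ (hv0.trans hvw)]
      linarith
    have h4 : cfDen α (k + 1) * ((v : ℝ)⁻¹ - (w : ℝ)⁻¹) ≤ (n k + 1 - cfDen α k : ℕ) := by
      rw [div_eq_mul_inv] at h1
      linarith
    have h5 := one_half_le_cfDen_mul_abs_cfErr hirr hα k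
    have h6 := mul_le_mul_of_nonneg_right h4 (abs_nonneg (cfErr α k))
    rw [Nat.cast_zero, sub_zero]
    nlinarith
  · filter_upwards [hnt.eventually_gt_atTop 0] with k hk0 z hz
    obtain ⟨j, hj, hzj⟩ := Set.mem_iUnion₂.1 hz
    rw [Finset.mem_Ico] at hj
    have h1 : cfDen α (k + 1) ≤ cylReturn α (circleCode hα z).1 (n k) :=
      cfDen_succ_le_cylReturn hα hirr (t := circleRep z) (j := j) (fun _ _ => rfl) (by omega) hzj
    rw [ENNReal.le_div_iff_mul_le (Or.inl (by exact_mod_cast hk0.ne'))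
      (Or.inl (ENNReal.natCast_ne_top _))]
    have h2 : (v : ENNReal) * (n k : ℕ) ≤ (cfDen α (k + 1) : ℕ) := by
      have := hnv k
      rw [mul_comm] at this
      exact_mod_cast this
    refine h2.trans ?_
    exact_mod_cast h1

theorem ae_lowerRate_le {v : NNReal} (hv : v ≤ 1) (hv' : rZero α < v) :
    ∀ᵐ z, lowerRate (mapsTo_shift α) (circleCode hα z) ≤ v := by
  obtain ⟨w, hw, hwv⟩ := ENNReal.lt_iff_exists_nnreal_btwn.1 hv'
  have hwv : (w : ℝ) < v := by exact_mod_cast hwv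
  have hv1 : (v : ℝ) ≤ 1 := by exact_mod_cast hv
  have hv0 : (0 : ℝ) < v := w.2.trans_lt hwv
  have hq : ∀ k, (1 : ℝ) ≤ cfDen α k := fun k => by exact_mod_cast cfDen_pos hirr hα k
  -- The smallest length at which `τ ≤ q_k` forces `τ / n ≤ v`. As `v ≤ 1`, it is at least `q_k`, so
  -- fewer than `q_{k+1}` arcs are used and they are disjoint.
  set n : ℕ → ℕ := fun k => ⌈(cfDen α k : ℝ) / v⌉₊ with hn
  have hnt : Tendsto n atTop atTop :=
    tendsto_nat_ceil_atTop.comp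
      ((tendsto_natCast_atTop_atTop.comp (tendsto_cfDen hirr hα)).atTop_div_const hv0)
  have hnv : ∀ k, (cfDen α k : ℝ) ≤ n k * v := fun k => (div_le_iff₀ hv0).1 (Nat.le_ceil _)
  have hnq : ∀ k, cfDen α k ≤ n k := fun k => by
    have : (cfDen α k : ℝ) ≤ n k := by nlinarith [hnv k, Nat.cast_nonneg (α := ℝ) (n k)]
    exact_mod_cast this
  set d : ℝ := 1 - w / v with hd
  have hd0 : 0 < d := by
    have := (div_lt_one hv0).2 hwv
    linarith
  refine ae_lowerRate_le_of_frequently hirr hα (n := n)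
    (E := fun k => ⋃ j ∈ Finset.Ico (n k + 1) (cfDen α (k + 1) + cfDen α k),
      rotatedArc α (-cfErr α k) j)
    (fun k => Finset.measurableSet_biUnion _ fun j _ => measurableSet_rotatedArc j) hnt
    (ENNReal.ofReal_pos.2 (by positivity : 0 < d / 4)) ?_ ?_
  -- The number of arcs is at least `d q_{k+1} - 1`; for `q_{k+1} ≥ 2 / d` the rounding loss costs
  -- at most half of it.
  · have hlarge : ∀ᶠ k in atTop, 2 / d ≤ cfDen α (k + 1) :=
      (tendsto_natCast_atTop_atTop.comp
        ((tendsto_cfDen hirr hα).comp (tendsto_add_atTop_nat 1))).eventually_ge_atTop _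
    refine ((frequently_lt_of_liminf_lt (by isBoundedDefault) hw).and_eventually hlarge).mono
      fun k hk => ?_
    obtain ⟨hk, hk2⟩ := hk
    have hk1 : (cfDen α k : ℝ) < w * (cfDen α (k + 1) + cfDen α k - 1) := by
      have hpos := cfDen_pos hirr hα (k + 1)
      have hpos' := cfDen_pos hirr hα k
      have e : (cfDen α (k + 1) : ENNReal) + cfDen α k - 1 =
          (cfDen α (k + 1) + cfDen α k - 1 : ℕ) := by simp
      have h0 : ((cfDen α (k + 1) + cfDen α k - 1 : ℕ) : ENNReal) ≠ 0 :=
        Nat.cast_ne_zero.2 (by omega)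
      rw [e, ENNReal.div_lt_iff (Or.inl h0) (Or.inl (ENNReal.natCast_ne_top _))] at hk
      have h1 : (cfDen α k : ℝ) < w * (cfDen α (k + 1) + cfDen α k - 1 : ℕ) := by
        exact_mod_cast hk
      rw [Nat.cast_sub (by omega)] at h1
      push_cast at h1
      exact h1
    refine le_trans (ENNReal.ofReal_le_ofReal ?_)
      (le_volume_iUnion_rotatedArc (D := -cfErr α k) (a := n k + 1)
        (b := cfDen α (k + 1) + cfDen α k) hirr hα (abs_neg _) (by have := hnq k; omega))
    have h1 : (n k : ℝ) < cfDen α k / v + 1 := Nat.ceil_lt_add_one (by positivity)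
    have h2 : (cfDen α k : ℝ) / v ≤ (1 - d) * (cfDen α (k + 1) + cfDen α k - 1) := by
      rw [hd, div_le_iff₀ hv0, sub_sub_cancel]
      calc (cfDen α k : ℝ) ≤ w * (cfDen α (k + 1) + cfDen α k - 1) := hk1.le
        _ = w / v * (cfDen α (k + 1) + cfDen α k - 1) * v := by field_simp
    have h3 : 2 ≤ cfDen α (k + 1) * d := (div_le_iff₀ hd0).1 hk2
    have h4 : d / 2 * cfDen α (k + 1) ≤
        ((cfDen α (k + 1) + cfDen α k : ℕ) : ℝ) - (n k + 1 : ℕ) := by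
      push_cast
      nlinarith [hq k]
    have h5 := one_half_le_cfDen_mul_abs_cfErr hirr hα k
    have h6 := mul_le_mul_of_nonneg_right h4 (abs_nonneg (cfErr α k))
    nlinarith
  · filter_upwards [hnt.eventually_gt_atTop 0] with k hk0 z hz
    obtain ⟨j, hj, hzj⟩ := Set.mem_iUnion₂.1 hz
    rw [Finset.mem_Ico] at hj
    have h1 : cylReturn α (circleCode hα z).1 (n k) ≤ cfDen α k :=
      cylReturn_le_cfDen_of_floor_ne hα hirr (t := circleRep z) (j := j) (fun _ _ => rfl)
        (by omega) (by omega) (by rw [sub_eq_add_neg]; exact hzj)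
    refine ENNReal.div_le_of_le_mul ?_
    have h2 : ((cfDen α k : ℕ) : ENNReal) ≤ (v : ENNReal) * (n k : ℕ) := by
      have := hnv k
      rw [mul_comm] at this
      exact_mod_cast this
    refine le_trans ?_ h2
    exact_mod_cast h1

include hα in
theorem one_lt_rOne : 1 < rOne α := by
  refine lt_of_lt_of_le ?_ (ofReal_goldenRatio_le_rOne hirr hα)
  rw [← ENNReal.ofReal_one]
  exact (ENNReal.ofReal_lt_ofReal_iff Real.goldenRatio_pos).2 Real.one_lt_goldenRatio

include hα in
theorem rZero_lt_one : rZero α < 1 := by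
  rw [rZero_eq_inv hirr hα, ENNReal.inv_lt_one]
  exact (one_lt_rOne hirr hα).trans_le le_self_add

theorem ae_upperRate_eq :
    ∀ᵐ z, upperRate (mapsTo_shift α) (circleCode hα z) = rOne α := by
  have h1 : ∀ q : ℚ, ∀ᵐ z, 1 ≤ (q : ℝ).toNNReal → ((q : ℝ).toNNReal : ENNReal) < rOne α →
      ((q : ℝ).toNNReal : ENNReal) ≤ upperRate (mapsTo_shift α) (circleCode hα z) := by
    intro q
    by_cases h : 1 ≤ (q : ℝ).toNNReal ∧ ((q : ℝ).toNNReal : ENNReal) < rOne α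
    · filter_upwards [ae_le_upperRate hirr hα h.1 h.2] with z hz _ _ using hz
    · exact Eventually.of_forall fun z h2 h3 => absurd ⟨h2, h3⟩ h
  filter_upwards [ae_all_iff.2 h1] with z hz
  refine le_antisymm (upperRate_le_rOne hirr hα _) ?_
  by_contra! hlt
  -- Taking the maximum with `1` makes `q ≥ 1`, as `ae_le_upperRate` requires; `1 < r_1` leaves room
  -- for it.
  obtain ⟨q, -, hq1, hq2⟩ := ENNReal.lt_iff_exists_rat_btwn.1
    (max_lt hlt (one_lt_rOne hirr hα))
  have h2 := (le_max_right _ _).trans hq1.le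
  exact absurd (hz q (by exact_mod_cast h2) hq2) (not_le.2 ((le_max_left _ _).trans_lt hq1))

theorem ae_lowerRate_eq :
    ∀ᵐ z, lowerRate (mapsTo_shift α) (circleCode hα z) = rZero α := by
  have h1 : ∀ q : ℚ, ∀ᵐ z, (q : ℝ).toNNReal ≤ 1 → rZero α < ((q : ℝ).toNNReal : ENNReal) →
      lowerRate (mapsTo_shift α) (circleCode hα z) ≤ ((q : ℝ).toNNReal : ENNReal) := by
    intro q
    by_cases h : (q : ℝ).toNNReal ≤ 1 ∧ rZero α < ((q : ℝ).toNNReal : ENNReal)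
    · filter_upwards [ae_lowerRate_le hirr hα h.1 h.2] with z hz _ _ using hz
    · exact Eventually.of_forall fun z h2 h3 => absurd ⟨h2, h3⟩ h
  filter_upwards [ae_all_iff.2 h1] with z hz
  refine le_antisymm ?_ (rZero_le_lowerRate hirr hα _)
  by_contra! hlt
  -- The minimum with `1` secures `q ≤ 1` for `ae_lowerRate_le`, and `r_0 < 1` leaves room for it.
  obtain ⟨q, -, hq1, hq2⟩ := ENNReal.lt_iff_exists_rat_btwn.1
    (lt_min hlt (rZero_lt_one hirr hα))
  have h2 := hq2.le.trans (min_le_right _ _)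
  exact absurd (hz q (by exact_mod_cast h2) hq1) (not_le.2 (hq2.trans_le (min_le_left _ _)))

theorem ae_rates_eq : ∀ᵐ x ∂(sturmianMeasure hα),
    lowerRate (mapsTo_shift α) x = rZero α ∧ upperRate (mapsTo_shift α) x = rOne α := by
  have hmeas : MeasurableSet {x : sturmian α |
      lowerRate (mapsTo_shift α) x = rZero α ∧ upperRate (mapsTo_shift α) x = rOne α} :=
    (measurableSet_eq_fun measurable_lowerRate measurable_const).inter
      (measurableSet_eq_fun measurable_upperRate measurable_const)
  rw [sturmianMeasure, ae_map_iff (measurable_circleCode hα).aemeasurable hmeas]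
  exact (ae_lowerRate_eq hirr hα).and (ae_upperRate_eq hirr hα)

end AlmostSure

end SturmianReturn

theorem mainTheorem1 (α : ℝ) (hirr : Irrational α) (hα : α ∈ Set.Ioo (0 : ℝ) 1) :
    (∀ x : SturmianReturn.sturmian α,
      SturmianReturn.rZero α ≤ SturmianReturn.lowerRate (SturmianReturn.mapsTo_shift α) x ∧
      SturmianReturn.lowerRate (SturmianReturn.mapsTo_shift α) x ≤
        SturmianReturn.upperRate (SturmianReturn.mapsTo_shift α) x ∧
      SturmianReturn.upperRate (SturmianReturn.mapsTo_shift α) x ≤ SturmianReturn.rOne α) ∧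
    (∃ μ : MeasureTheory.Measure (SturmianReturn.sturmian α),
      MeasureTheory.IsProbabilityMeasure μ ∧
      MeasureTheory.MeasurePreserving (SturmianReturn.sturmianMap α) μ μ ∧
      (∀ ν : MeasureTheory.Measure (SturmianReturn.sturmian α),
        MeasureTheory.IsProbabilityMeasure ν →
        MeasureTheory.MeasurePreserving (SturmianReturn.sturmianMap α) ν ν → ν = μ) ∧
      (∀ᵐ x ∂μ,
        SturmianReturn.lowerRate (SturmianReturn.mapsTo_shift α) x = SturmianReturn.rZero α ∧
        SturmianReturn.upperRate (SturmianReturn.mapsTo_shift α) x = SturmianReturn.rOne α)) ∧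
    (¬ BddAbove (Set.range (SturmianReturn.cfCoeff α)) →
      SturmianReturn.rZero α = 0 ∧ SturmianReturn.rOne α = ⊤) ∧
    (BddAbove (Set.range (SturmianReturn.cfCoeff α)) →
      1 / (SturmianReturn.coeffLimsup α + 2) ≤ SturmianReturn.rZero α ∧
      SturmianReturn.rZero α ≤ ENNReal.ofReal (Real.goldenRatio ^ (-2 : ℤ)) ∧
      ENNReal.ofReal (Real.goldenRatio ^ (-2 : ℤ)) < ENNReal.ofReal Real.goldenRatio ∧
      ENNReal.ofReal Real.goldenRatio ≤ SturmianReturn.rOne α ∧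
      SturmianReturn.rOne α ≤ SturmianReturn.coeffLimsup α + 1 ∧
      (SturmianReturn.rOne α = ENNReal.ofReal Real.goldenRatio ↔
        SturmianReturn.coeffLimsup α = 1) ∧
      (SturmianReturn.rZero α = ENNReal.ofReal (Real.goldenRatio ^ (-2 : ℤ)) ↔
        SturmianReturn.coeffLimsup α = 1)) := by

  open SturmianReturn in
  exact ⟨fun x => ⟨rZero_le_lowerRate hirr hα x, lowerRate_le_upperRate x,
      upperRate_le_rOne hirr hα x⟩,
    ⟨sturmianMeasure hα, inferInstance, measurePreserving_sturmianMap hα,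
      fun ν _ hν => eq_sturmianMeasure hirr hα ν hν, ae_rates_eq hirr hα⟩,
    constants_of_not_bddAbove hirr hα, fun _ => constants_bounds hirr hα⟩
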